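/- **Conventions.** $\mathbb N=\{1,2,\dots\}$; $[\mathbb N]^{<\omega}$ is the set of finite subsets of $\mathbb N$, whose members are identified with strictly increasing tuples of positive integers. For finite sets, $s<t$ means $x<y$ for all $x\in s$, $y\in t$. A family $\mathcal F\subseteq[\mathbb N]^{<\omega}$ is a *tree* if $\mathcal F^*=\mathcal F$, where $\mathcal F^*$ consists of $\emptyset$ and all initial segments of members of $\mathcal F$. For every countable limit ordinal $\lambda$ fix a strictly increasing sequence $(\lambda_n)_{n\ge1}$ of successor ordinals with $\lambda_n<\lambda$ and $\sup_n\lambda_n=\lambda$. The families $\mathcal A_\xi\subseteq[\mathbb N]^{<\omega}$, $\xi<\omega_1$, are defined recursively: 1. $\mathcal A_0=\{\emptyset\}$; 2. $\mathcal A_{\zeta+1}=\{\{n\}\cup s: n\in\mathbb N,\ \{n\}<s,\ s\in\mathcal A_\zeta\}$; 3. $\mathcal A_{\omega^{\beta+1}}=\{s_1\cup\dots\cup s_n: s_1<\dots<s_n,\ s_i\in\mathcal A_{\omega^\beta},\ n=\min s_1\}$; 4. $\mathcal A_{\omega^\lambda}=\{s\neq\emptyset: s\in\mathcal A_{\omega^{\lambda_n}}\text{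 with } n=\min s\}$ for limit $\lambda$; 5. if $\xi=\omega^{a_0}p_0+\omega^{a_1}p_1+\dots+\omega^{a_m}p_m$ with $a_0>a_1>\dots>a_m>0$, $p_i\in\mathbb N$, and $m\ge1$ or $p_0>1$, then $\mathcal A_\xi$ consists of the sets $s_0\cup s_1\cup\dots\cup s_m$ with $s_m<\dots<s_1<s_0$, where each $s_i$ is a union of $p_i$ sets $s^i_1<\dots<s^i_{p_i}$ in $\mathcal A_{\omega^{a_i}}$. Let $\varphi(s)=\sum_{\ell\in s}2^{\ell-1}$, a bijection from the nonempty finite subsets of $\mathbb N$ onto $\mathbb N$, and $c(n)=\min\varphi^{-1}(n)$. For $L\subseteq\mathbb N$ and $1\le\xi<\omega_1$ put $$P^\xi(L)=\Big\{\Big(\sum_{\ell\in s_1}\ell,\dots,\sum_{\ell\in s_k}\ell\Big): k\ge1,\ s_1<\dots<s_k\text{ nonempty finite subsets of }L,\ (c(\min s_1),\dots,c(\min s_k))\in\mathcal A_\xi\Big\},$$ $$P(L)=\Big\{\Big(\sum_{\ell\in s_1}\ell,\dots,\sum_{\ell\in s_k}\ell\Big): k\ge1,\ s_1<\dots<s_k\text{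 nonempty finite subsets of }L\Big\}.$$ **Corollary 3.6.** Let $\mathcal F\subseteq[\mathbb N]^{<\omega}$ be a tree. Call an infinite set $L\subseteq\mathbb N$ *admissible* if $\varphi^{-1}(\ell)<\varphi^{-1}(\ell')$ whenever $\ell<\ell'$ are in $L$. Then * either there is an admissible infinite $L\subseteq\mathbb N$ with $P(L)\subseteq\mathcal F$; * or there is a countable ordinal $\xi_0$ such that for every countable ordinal $\xi>\xi_0$ there is an admissible infinite $L\subseteq\mathbb N$ with $P^\xi(L)\subseteq[\mathbb N]^{<\omega}\setminus\mathcal F$. (The alternatives need not exclude each other. In particular, for admissible $L$ all tuples in $P(L)$ and $P^\xi(L)$ are strictly increasing.) -/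

import Mathlib

namespace BlockRamsey

open Ordinal

/-! Convention: the natural numbers of the theory are `1, 2, 3, …`; they are modelled by the
nonzero elements of `ℕ`. -/

/-- The family of all finite sets of positive integers. -/
def finSub : Set (Finset ℕ) := {s | ∀ n ∈ s, 1 ≤ n}

/-- `s < t` for finite sets: every element of `s` is smaller than every element of `t`.
For nonempty `s`, `t` this is `max s < min t`; it is vacuous if one of them is empty, and
nonemptiness is required separately wherever it matters. -/
def BlockLT (s t : Finset ℕ) : Prop := ∀ x ∈ s, ∀ y ∈ t, x < y

/-- `t` is an initial segment of `s` (possibly empty, possibly all of `s`). -/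
def IsInitialSegment (t s : Finset ℕ) : Prop := t ⊆ s ∧ ∀ x ∈ t, ∀ y ∈ s, y ≤ x → y ∈ t

/-- `F^*`: all initial segments of members of `F`, together with the empty set. -/
def initialSegments (F : Set (Finset ℕ)) : Set (Finset ℕ) :=
  {t | ∃ s ∈ F, IsInitialSegment t s} ∪ {∅}

/-- A family of finite sets is a tree if `F^* = F`. -/
def IsTree (F : Set (Finset ℕ)) : Prop := initialSegments F = F

/-- A choice, for every countable limit ordinal `l`, of a strictly increasing sequence
`lam l 1 < lam l 2 < ⋯` of successor ordinals smaller than `l` with supremum `l`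
(the values `lam l 0` are irrelevant). -/
def IsLimitChoice (lam : Ordinal.{0} → ℕ → Ordinal.{0}) : Prop :=
  ∀ l : Ordinal.{0}, Order.IsSuccLimit l → l < ω₁ →
    StrictMonoOn (lam l) (Set.Ici 1) ∧
    (∀ n : ℕ, 1 ≤ n → (∃ b : Ordinal.{0}, lam l n = b + 1) ∧ lam l n < l) ∧
    IsLUB (lam l '' Set.Ici 1) l

/-- `Schreier lam ξ s` says that `s` belongs to the family `A_ξ` of the recursive thin Schreier
system built from the choice `lam`. The five rules are the five clauses of the recursion; they
apply to disjoint classes of ordinals `ξ`, and each refers only to smaller ordinals. -/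
inductive Schreier (lam : Ordinal.{0} → ℕ → Ordinal.{0}) : Ordinal.{0} → Finset ℕ → Prop
  | zero : Schreier lam 0 ∅
  | succ (ζ : Ordinal.{0}) (n : ℕ) (s : Finset ℕ) (hn : 1 ≤ n) (hns : BlockLT {n} s)
      (hs : Schreier lam ζ s) : Schreier lam (ζ + 1) (insert n s)
  /-- `A_{ω^(β+1)}`: unions of `n` successive members of `A_{ω^β}`, where `n` is the minimum of
  the first one (equivalently of the union). -/
  | opow_succ (β : Ordinal.{0}) (n : ℕ) (t : Fin n → Finset ℕ)
      (ht : ∀ i, Schreier lam (ω ^ β) (t i))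
      (hlt : ∀ i j, i < j → BlockLT (t i) (t j))
      (hmin : IsLeast (↑(Finset.univ.biUnion t) : Set ℕ) n) :
      Schreier lam (ω ^ (β + 1)) (Finset.univ.biUnion t)
  /-- `A_{ω^l}` for a limit `l`: members of `A_{ω^(lam l n)}` with minimum `n`. -/
  | opow_limit (l : Ordinal.{0}) (hl : Order.IsSuccLimit l) (n : ℕ) (s : Finset ℕ)
      (hmin : IsLeast (↑s : Set ℕ) n) (hs : Schreier lam (ω ^ lam l n) s) :
      Schreier lam (ω ^ l) s
  /-- `ξ = ω^(a 0) * p 0 + ⋯ + ω^(a m) * p m` (Cantor normal form) with all exponents positive,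
  not a single power of `ω`: unions of `p i` successive members of `A_{ω^(a i)}` for every `i`,
  those for the smaller exponents coming first. -/
  | limit (m : ℕ) (a : Fin (m + 1) → Ordinal.{0}) (p : Fin (m + 1) → ℕ)
      (ha : StrictAnti a) (ha0 : ∀ i, 0 < a i) (hp : ∀ i, 1 ≤ p i) (hmp : 1 ≤ m ∨ 1 < p 0)
      (t : (i : Fin (m + 1)) → Fin (p i) → Finset ℕ)
      (ht : ∀ i j, Schreier lam (ω ^ a i) (t i j))
      (hlt : ∀ i j j', j < j' → BlockLT (t i j) (t i j'))
      (hlt' : ∀ i i', i < i' → ∀ j j', BlockLT (t i' j') (t i j)) :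
      Schreier lam (List.ofFn fun i => ω ^ a i * (p i : Ordinal.{0})).sum
        (Finset.univ.biUnion fun i => Finset.univ.biUnion (t i))

/-- The family `A_ξ`. -/
def schreierFamily (lam : Ordinal.{0} → ℕ → Ordinal.{0}) (ξ : Ordinal.{0}) : Set (Finset ℕ) :=
  {s | Schreier lam ξ s}

/-- `φ(s) = ∑_{l ∈ s} 2^(l-1)`, for finite nonempty sets `s` of positive integers. -/
def phi (s : Finset ℕ) : ℕ := ∑ l ∈ s, 2 ^ (l - 1)

/-- `φ⁻¹(n)`: the positions (counted from `1`) of the binary digits of `n` equal to `1`. -/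
def phiInv (n : ℕ) : Finset ℕ := n.bitIndices.toFinset.image (· + 1)

theorem phi_phiInv (n : ℕ) : phi (phiInv n) = n := by
  unfold phi phiInv
  rw [Finset.sum_image (by intro a _ b _ h; simpa using h)]
  simp only [Nat.add_sub_cancel]
  exact Finset.sum_toFinset_bitIndices_two_pow n

theorem phiInv_phi {s : Finset ℕ} (hs : s ∈ finSub) : phiInv (phi s) = s := by
  have h1 : phi s = ∑ i ∈ s.image (· - 1), 2 ^ i := by
    unfold phi
    rw [Finset.sum_image]
    intro a ha b hb h
    have := hs a ha
    have := hs b hb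
    simp only at h
    omega
  unfold phiInv
  rw [h1, Finset.toFinset_bitIndices_sum_two_pow, Finset.image_image]
  ext x
  simp only [Finset.mem_image, Function.comp]
  constructor
  · rintro ⟨a, ha, rfl⟩
    rwa [Nat.sub_add_cancel (hs a ha)]
  · intro hx
    exact ⟨x, hx, Nat.sub_add_cancel (hs x hx)⟩

/-- The minimum of a nonempty finite set of natural numbers. -/
noncomputable def minElt (s : Finset ℕ) : ℕ := sInf (↑s : Set ℕ)

/-- `c(n) = min φ⁻¹(n)`. -/
noncomputable def c (n : ℕ) : ℕ := minElt (phiInv n)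

/-- Finite sets of positive integers are identified with strictly increasing tuples: the set of
the increasing enumerations of the members of the family `G`. -/
def tuples (G : Set (Finset ℕ)) : Set (List ℕ) := {w | w.Pairwise (· < ·) ∧ w.toFinset ∈ G}

/-- `s_1 < ⋯ < s_k` are nonempty finite subsets of `L`, with `k ≥ 1`. -/
def IsBlockSeq (L : Set ℕ) (S : List (Finset ℕ)) : Prop :=
  S ≠ [] ∧ (∀ s ∈ S, s.Nonempty ∧ (↑s : Set ℕ) ⊆ L) ∧ S.Pairwise BlockLT

/-- The tuple `(∑_{l ∈ s_1} l, …, ∑_{l ∈ s_k} l)`. -/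
def sumTuple (S : List (Finset ℕ)) : List ℕ := S.map fun s => ∑ l ∈ s, l

/-- The `ξ`-sum set `P^ξ(L)`, for `ξ ≥ 1`. -/
def sumSet (lam : Ordinal.{0} → ℕ → Ordinal.{0}) (ξ : Ordinal.{0}) (L : Set ℕ) :
    Set (List ℕ) :=
  {w | ∃ S, IsBlockSeq L S ∧ (S.map fun s => c (minElt s)) ∈ tuples (schreierFamily lam ξ) ∧
    w = sumTuple S}

/-- The `k`-sum set `P^k(L)` for a positive integer `k`. -/
def finSumSet (k : ℕ) (L : Set ℕ) : Set (List ℕ) :=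
  {w | ∃ S, IsBlockSeq L S ∧ S.length = k ∧ w = sumTuple S}

/-- `P(L)`, the union of the `P^k(L)` over all positive integers `k`. -/
def allSums (L : Set ℕ) : Set (List ℕ) := ⋃ k ∈ Set.Ici 1, finSumSet k L

/-- `L` is an infinite set of positive integers of the form `φ(D)` with `D` an infinite disjoint
collection: `φ⁻¹(l) < φ⁻¹(l')` for all `l < l'` in `L`. -/
def IsSumBase (L : Set ℕ) : Prop :=
  L.Infinite ∧ (∀ l ∈ L, 1 ≤ l) ∧ ∀ l ∈ L, ∀ l' ∈ L, l < l' → BlockLT (phiInv l) (phiInv l')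

end BlockRamsey

/-!
A tree of finite sequences that branches into `U` at every node, for an ultrafilter `U`, can be
chosen so that it either avoids a given set `G` of sequences or is barred by `G`. If `U` is
idempotent for addition, all sequences of block sums of some infinite set run through this tree.

Applied to the complement of `F`, the first case is the first alternative of the theorem. In the
second case the block sums that lie in `F` form a well-founded tree, of some countable rank `ξ₀`.
For `ξ > ξ₀` the dichotomy is applied again, now to the block sums in `F` whose images under `c` lie
in `𝒜_ξ`. Being barred is impossible: as `𝒜_ξ` is thin, all block sums with image in `𝒜_ξ` would lie
in `F`, and as `𝒜_ξ` has rank at least `ξ` inside every infinite set, the rank of the tree would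
exceed `ξ₀`.
-/

namespace BlockRamsey

open Ordinal Filter

section Trees

universe u

variable {X Y : Type*}

/-- `T` has rank at least `α` at the node `w`, where `T` is a set of tuples ordered by extension.
A lower bound for the rank makes sense for ill-founded `T` too. -/
def HasRankGE (T : Set (List X)) (α : Ordinal.{u}) (w : List X) : Prop :=
  w ∈ T ∧ ∀ β < α, ∃ x, HasRankGE T β (w ++ [x])
termination_by α

theorem hasRankGE_iff {T : Set (List X)} {α : Ordinal.{u}} {w : List X} :
    HasRankGE T α w ↔ w ∈ T ∧ ∀ β < α, ∃ x, HasRankGE T β (w ++ [x]) := by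
  rw [HasRankGE]

theorem HasRankGE.mem {T : Set (List X)} {α : Ordinal.{u}} {w : List X}
    (h : HasRankGE T α w) : w ∈ T :=
  (hasRankGE_iff.1 h).1

theorem HasRankGE.mono {T : Set (List X)} {α β : Ordinal.{u}} {w : List X}
    (h : HasRankGE T α w) (hβ : β ≤ α) : HasRankGE T β w :=
  hasRankGE_iff.2 ⟨h.mem, fun γ hγ => (hasRankGE_iff.1 h).2 γ (hγ.trans_le hβ)⟩

theorem HasRankGE.map {T : Set (List X)} {T' : Set (List Y)} {f : List X → List Y}
    (hf : ∀ w x, ∃ y, f (w ++ [x]) = f w ++ [y]) (hT : Set.MapsTo f T T') {α : Ordinal.{u}}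
    {w : List X} (h : HasRankGE T α w) : HasRankGE T' α (f w) := by
  induction α using WellFoundedLT.induction generalizing w with
  | _ α ih =>
    refine hasRankGE_iff.2 ⟨hT h.mem, fun β hβ => ?_⟩
    obtain ⟨x, hx⟩ := (hasRankGE_iff.1 h).2 β hβ
    obtain ⟨y, hy⟩ := hf w x
    exact ⟨y, hy ▸ ih β hβ hx⟩

theorem HasRankGE.subset {T T' : Set (List X)} (hT : T ⊆ T') {α : Ordinal.{u}} {w : List X}
    (h : HasRankGE T α w) : HasRankGE T' α w :=
  h.map (f := id) (fun _ x => ⟨x, rfl⟩) hT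

theorem hasRankGE_of_isSuccLimit {T : Set (List X)} {α : Ordinal.{u}} (hα : Order.IsSuccLimit α)
    {w : List X} (h : ∀ β < α, HasRankGE T β w) : HasRankGE T α w :=
  hasRankGE_iff.2 ⟨(h 0 hα.bot_lt).mem, fun β hβ =>
    (hasRankGE_iff.1 (h (β + 1) (hα.add_one_lt hβ))).2 β (Order.lt_add_one_iff.2 le_rfl)⟩

/-- `T` contains the initial segments of its members. -/
def IsPrefixClosed (T : Set (List X)) : Prop := ∀ ⦃v w⦄, v <+: w → w ∈ T → v ∈ T

theorem HasRankGE.of_prefix {T : Set (List X)} (hT : IsPrefixClosed T) {α : Ordinal.{u}}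
    {v w : List X} (hvw : v <+: w) (h : HasRankGE T α w) : HasRankGE T α v := by
  obtain ⟨u, rfl⟩ := hvw
  induction u generalizing v with
  | nil => simpa using h
  | cons x u ih =>
    have hx : HasRankGE T α (v ++ [x]) := ih (by simpa using h)
    exact hasRankGE_iff.2 ⟨hT (List.prefix_append _ _) hx.mem, fun β hβ => ⟨x, hx.mono hβ.le⟩⟩

theorem HasRankGE.add {T T' : Set (List X)} {η ξ : Ordinal.{u}}
    (hT : ∀ w ∈ T, HasRankGE T' η w) {w : List X} (h : HasRankGE T ξ w) :
    HasRankGE T' (η + ξ) w := by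
  induction ξ using WellFoundedLT.induction generalizing w with
  | _ ξ ih =>
    refine hasRankGE_iff.2 ⟨(hT w h.mem).mem, fun β hβ => ?_⟩
    rcases lt_or_ge β η with hβη | hηβ
    · exact (hasRankGE_iff.1 (hT w h.mem)).2 β hβη
    · have hlt : β - η < ξ := (Ordinal.sub_lt_of_le hηβ).2 hβ
      obtain ⟨x, hx⟩ := (hasRankGE_iff.1 h).2 _ hlt
      exact ⟨x, Ordinal.add_sub_cancel_of_le hηβ ▸ ih _ hlt hx⟩

/-- The one-step extensions of `p` inside `A`. -/
def successors (A : Set (List X)) (p : List X) : Set X := {x | p ++ [x] ∈ A}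

/-- `G` bars `w`: there is a well-founded tree above `w`, branching at each node `p` over a set in
the filter `𝓕 p`, all of whose leaves lie in `G`. For constant `𝓕` this is branching in the sense
of one filter; for `𝓕 p = 𝓟 (successors A p)` every path through `A` above `w` meets `G`. -/
inductive Bar (𝓕 : List X → Filter X) (G : Set (List X)) : List X → Prop
  | hit (w : List X) (h : w ∈ G) : Bar 𝓕 G w
  | step (w : List X) (A : Set X) (hA : A ∈ 𝓕 w) (h : ∀ x ∈ A, Bar 𝓕 G (w ++ [x])) : Bar 𝓕 G w

theorem Bar.mono_filter {𝓕 𝓕' : List X → Filter X} {G : Set (List X)} {w : List X}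
    (h : Bar 𝓕 G w) (hle : ∀ p, w <+: p → 𝓕' p ≤ 𝓕 p) : Bar 𝓕' G w := by
  induction h with
  | hit w h => exact .hit w h
  | step w A hA _ ih =>
    exact .step w A (hle w List.prefix_rfl hA) fun x hx =>
      ih x hx fun p hp => hle p ((List.prefix_append _ _).trans hp)

theorem Bar.exists_principal {𝓕 : List X → Filter X} {G : Set (List X)} {w : List X}
    (h : Bar 𝓕 G w) : ∃ W : List X → Set X, (∀ p, W p ∈ 𝓕 p) ∧ Bar (fun p => 𝓟 (W p)) G w := by
  induction h with
  | hit w h => exact ⟨fun _ => Set.univ, fun _ => univ_mem, .hit w h⟩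
  | step w A hA _ ih =>
    choose! W hW𝓕 hW using ih
    classical
    -- A node extending `w ++ [x]` with `x ∈ A` is governed by the tree `W x`.
    let V : List X → Set X := fun p =>
      if p = w then A else if h : ∃ x ∈ A, w ++ [x] <+: p then W h.choose p else Set.univ
    have hV : ∀ x ∈ A, ∀ p, w ++ [x] <+: p → V p = W x p := by
      intro x hx p hp
      have hex : ∃ y ∈ A, w ++ [y] <+: p := ⟨x, hx, hp⟩
      have hchoose : hex.choose = x := by
        have hpre := List.prefix_of_prefix_length_le hex.choose_spec.2 hp (by simp)
        simpa using hpre.eq_of_length (by simp)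
      have hpw : p ≠ w := by
        rintro rfl
        simpa using hp.length_le
      simp only [V, if_neg hpw, dif_pos hex, hchoose]
    refine ⟨V, fun p => ?_, .step w A (by simp [V]) fun x hx =>
      (hW x hx).mono_filter fun p hp => by rw [hV x hx p hp]⟩
    by_cases hpw : p = w
    · simpa [V, hpw] using hA
    by_cases hex : ∃ x ∈ A, w ++ [x] <+: p
    · obtain ⟨x, hx, hp⟩ := hex
      exact hV x hx p hp ▸ hW𝓕 x hx p
    · simp [V, hpw, hex]

/-- `l` is a branch of the tree whose node `p` is continued by the elements of `W p`. -/
def Follows (W : List X → Set X) (l : List X) : Prop := ∀ p x, p ++ [x] <+: l → x ∈ W p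

theorem follows_nil (W : List X → Set X) : Follows W [] := by
  simp [Follows]

theorem follows_concat {W : List X → Set X} {l : List X} {x : X} :
    Follows W (l ++ [x]) ↔ Follows W l ∧ x ∈ W l := by
  refine ⟨fun h => ⟨fun p y hp => h p y (hp.trans (List.prefix_append _ _)),
    h l x List.prefix_rfl⟩, fun ⟨h, hx⟩ p y hp => ?_⟩
  rcases List.prefix_concat_iff.1 hp with heq | hpl
  · obtain ⟨rfl, rfl⟩ : p = l ∧ y = x := by simpa using heq
    exact hx
  · exact h p y hpl

theorem Follows.mono {W W' : List X → Set X} (h : ∀ p, W p ⊆ W' p) {l : List X}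
    (hl : Follows W l) : Follows W' l :=
  fun p x hp => h p (hl p x hp)

theorem Follows.induction {W : List X → Set X} {P : List X → Prop} (nil : P [])
    (concat : ∀ p, ∀ x ∈ W p, P p → P (p ++ [x])) {l : List X} (hl : Follows W l) : P l := by
  induction l using List.reverseRecOn with
  | nil => exact nil
  | append_singleton l x ih =>
    obtain ⟨hl, hx⟩ := follows_concat.1 hl
    exact concat l x hx (ih hl)

/-- Ultrafilter form of the Nash-Williams dichotomy: almost all successors of an unbarred node are
unbarred. -/
theorem exists_tree_avoids_or_bar (U : Ultrafilter X) (G : Set (List X)) :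
    ∃ W : List X → Set X, (∀ p, W p ∈ U) ∧
      ((∀ w, Follows W w → w ∉ G) ∨ Bar (fun p => 𝓟 (W p)) G []) := by
  by_cases h : Bar (fun _ => (U : Filter X)) G []
  · obtain ⟨W, hWU, hW⟩ := h.exists_principal
    exact ⟨W, hWU, .inr hW⟩
  let Barred : List X → Prop := Bar (fun _ => (U : Filter X)) G
  refine ⟨fun p => {x | ¬ Barred p → ¬ Barred (p ++ [x])}, fun p => ?_, .inl fun w hw hwG => ?_⟩
  · by_cases hp : Barred p
    · exact mem_of_superset univ_mem fun _ _ h => absurd hp h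
    · have hx : ∀ᶠ x in U, ¬ Barred (p ++ [x]) :=
        Ultrafilter.eventually_not.2 fun hU => hp (.step p _ hU fun _ hx => hx)
      filter_upwards [hx] with x hx _ using hx
  · exact hw.induction (P := fun v => ¬ Barred v) h (fun _ _ hx => hx) (.hit w hwG)

theorem Bar.exists_not_hasRankGE [Countable X] {A G : Set (List X)} {w : List X}
    (h : Bar (fun p => 𝓟 (successors A p)) G w) :
    ∃ α < ω₁, ¬ HasRankGE (A \ G) α w := by
  induction h with
  | hit w h => exact ⟨0, omega_pos 1, fun hr => hr.mem.2 h⟩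
  | step w _ hB _ ih =>
    have hbound : ∀ x, ∃ α < ω₁, ¬ HasRankGE (A \ G) α (w ++ [x]) := by
      intro x
      by_cases hx : w ++ [x] ∈ A
      · exact ih x (hB hx)
      · exact ⟨0, omega_pos 1, fun hr => hx hr.mem.1⟩
    choose α hα hrank using hbound
    refine ⟨(⨆ x, α x) + 1,
      (Cardinal.isSuccLimit_omega 1).add_one_lt (iSup_lt_omega_one hα), fun hw => ?_⟩
    obtain ⟨x, hx⟩ := (hasRankGE_iff.1 hw).2 _ (Order.lt_add_one_iff.2 le_rfl)
    exact hrank x (hx.mono (Ordinal.le_iSup α x))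

theorem Bar.exists_comparable {A G : Set (List X)} (hA : IsPrefixClosed A)
    (hext : ∀ w ∈ A, (successors A w).Nonempty) {v w : List X}
    (h : Bar (fun p => 𝓟 (successors A p)) G v) (hv : v ∈ A) (hw : w ∈ A)
    (hvw : v <+: w ∨ w <+: v) : ∃ g ∈ G, g <+: w ∨ w <+: g := by
  induction h with
  | hit v h => exact ⟨v, h, hvw⟩
  | step v B hB _ ih =>
    obtain ⟨x, hx, hcomp⟩ : ∃ x, v ++ [x] ∈ A ∧ (v ++ [x] <+: w ∨ w <+: v ++ [x]) := by
      rcases hvw with ⟨_ | ⟨x, u⟩, rfl⟩ | hwv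
      · obtain ⟨x, hx⟩ := hext v hv
        exact ⟨x, hx, .inr (by simp)⟩
      · have hpre : v ++ [x] <+: v ++ x :: u := by simp
        exact ⟨x, hA hpre hw, .inl hpre⟩
      · obtain ⟨x, hx⟩ := hext v hv
        exact ⟨x, hx, .inr (hwv.trans (List.prefix_append _ _))⟩
    exact ih x (hB hx) hx hcomp

end Trees

section Families

/-- Concatenation of families: members of `C` followed by members of `B`. The order of the factors
is that of ordinal addition, in whose normal forms the last summand describes the beginning of
the set. -/
abbrev concatMonoid : Monoid (Set (Finset ℕ)) where
  mul B C := {s | ∃ t ∈ B, ∃ u ∈ C, BlockLT u t ∧ u ∪ t = s}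
  one := {∅}
  mul_assoc B C D := by
    ext s
    constructor
    · rintro ⟨_, ⟨t, ht, u, hu, hut, rfl⟩, v, hv, hvt, rfl⟩
      refine ⟨t, ht, _, ⟨u, hu, v, hv, fun x hx y hy => ?_, rfl⟩, fun x hx y hy => ?_, ?_⟩
      · exact hvt x hx y (Finset.mem_union_left _ hy)
      · rcases Finset.mem_union.1 hx with hx | hx
        · exact hvt x hx y (Finset.mem_union_right _ hy)
        · exact hut x hx y hy
      · exact Finset.union_assoc v u t
    · rintro ⟨t, ht, _, ⟨u, hu, v, hv, hvu, rfl⟩, hut, rfl⟩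
      refine ⟨_, ⟨t, ht, u, hu, fun x hx y hy => ?_, rfl⟩, v, hv, fun x hx y hy => ?_, ?_⟩
      · exact hut x (Finset.mem_union_right _ hx) y hy
      · rcases Finset.mem_union.1 hy with hy | hy
        · exact hvu x hx y hy
        · exact hut x (Finset.mem_union_left _ hx) y hy
      · exact (Finset.union_assoc v u t).symm
  one_mul B := by
    ext s
    constructor
    · rintro ⟨_, rfl, u, hu, -, rfl⟩
      simpa using hu
    · exact fun hs => ⟨∅, rfl, s, hs, by simp [BlockLT], by simp⟩
  mul_one B := by
    ext s
    constructor
    · rintro ⟨t, ht, _, rfl, -, rfl⟩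
      simpa using ht
    · exact fun hs => ⟨s, hs, ∅, rfl, by simp [BlockLT], by simp⟩

attribute [local instance] concatMonoid

theorem mem_mul {B C : Set (Finset ℕ)} {s : Finset ℕ} :
    s ∈ B * C ↔ ∃ t ∈ B, ∃ u ∈ C, BlockLT u t ∧ u ∪ t = s :=
  Iff.rfl

theorem mem_one {s : Finset ℕ} : s ∈ (1 : Set (Finset ℕ)) ↔ s = ∅ :=
  Iff.rfl

theorem mem_prod_ofFn {k : ℕ} {B : Fin k → Set (Finset ℕ)} {s : Finset ℕ} :
    s ∈ (List.ofFn B).prod ↔ ∃ t : Fin k → Finset ℕ, (∀ i, t i ∈ B i) ∧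
      (∀ i j, i < j → BlockLT (t j) (t i)) ∧ Finset.univ.biUnion t = s := by
  induction k generalizing s with
  | zero => simp [mem_one, eq_comm]
  | succ k ih =>
    have hunion (t : Finset ℕ) (v : Fin k → Finset ℕ) :
        Finset.univ.biUnion (Fin.cons t v : Fin (k + 1) → Finset ℕ) =
          Finset.univ.biUnion v ∪ t := by
      ext x
      simp [Fin.exists_fin_succ, or_comm]
    have hlt (t : Finset ℕ) (v : Fin k → Finset ℕ) :
        BlockLT (Finset.univ.biUnion v) t ↔ ∀ j, BlockLT (v j) t := by
      simp only [BlockLT, Finset.mem_biUnion, Finset.mem_univ, true_and]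
      grind
    rw [List.ofFn_succ, List.prod_cons, mem_mul, Fin.exists_fin_succ_pi]
    simp only [ih, Fin.forall_fin_succ, Fin.cons_zero, Fin.cons_succ, hunion, Fin.not_lt_zero,
      Fin.succ_lt_succ_iff, Fin.succ_pos, false_imp_iff, true_imp_iff, true_and]
    constructor
    · rintro ⟨t, ht, _, ⟨v, hv, hvv, rfl⟩, hvt, rfl⟩
      exact ⟨t, v, ⟨ht, hv⟩, ⟨(hlt t v).1 hvt, hvv⟩, rfl⟩
    · rintro ⟨t, v, ⟨ht, hv⟩, ⟨hvt, hvv⟩, rfl⟩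
      exact ⟨t, ht, _, ⟨v, hv, hvv, rfl⟩, (hlt t v).2 hvt, rfl⟩

theorem mem_pow {k : ℕ} {B : Set (Finset ℕ)} {s : Finset ℕ} :
    s ∈ B ^ k ↔ ∃ t : Fin k → Finset ℕ, (∀ i, t i ∈ B) ∧
      (∀ i j, i < j → BlockLT (t i) (t j)) ∧ Finset.univ.biUnion t = s := by
  rw [← List.prod_replicate, ← List.ofFn_const, mem_prod_ofFn]
  have hunion (t : Fin k → Finset ℕ) :
      Finset.univ.biUnion (fun i : Fin k => t i.rev) = Finset.univ.biUnion t := by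
    ext x
    simpa using (Fin.rev_surjective.exists (p := fun i => x ∈ t i)).symm
  constructor
  all_goals
    rintro ⟨t, ht, hlt, rfl⟩
    exact ⟨fun i => t i.rev, fun i => ht _, fun i j h => hlt _ _ (Fin.rev_lt_rev.2 h), hunion t⟩

/-- The members of `𝓑 n` with minimum `n`, over all positive `n`. -/
def diagonal (𝓑 : ℕ → Set (Finset ℕ)) : Set (Finset ℕ) :=
  {s | ∃ n, 1 ≤ n ∧ IsLeast (↑s : Set ℕ) n ∧ s ∈ 𝓑 n}

theorem diagonal_congr {𝓑 𝓒 : ℕ → Set (Finset ℕ)} (h : ∀ n, 1 ≤ n → 𝓑 n = 𝓒 n) :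
    diagonal 𝓑 = diagonal 𝓒 := by
  ext s
  exact exists_congr fun n => and_congr_right fun hn => by rw [h n hn]

theorem diagonal_diagonal (𝓑 : ℕ → ℕ → Set (Finset ℕ)) :
    diagonal (fun n => diagonal (𝓑 n)) = diagonal fun n => 𝓑 n n := by
  ext s
  constructor
  · rintro ⟨n, hn, hs, m, -, hm, h⟩
    exact ⟨n, hn, hs, hm.unique hs ▸ h⟩
  · rintro ⟨n, hn, hs, h⟩
    exact ⟨n, hn, hs, n, hn, hs, h⟩

/-- The family of the singletons of positive integers. -/
def singletons : Set (Finset ℕ) := {s | ∃ n, 1 ≤ n ∧ s = {n}}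

end Families

section CantorNormalForm

universe u

/-- The ordinal `∑ ω ^ a * p` over the pairs `(a, p)` of a list. -/
noncomputable def cnfSum (l : List (Ordinal.{u} × ℕ)) : Ordinal.{u} :=
  (l.map fun x => ω ^ x.1 * (x.2 : Ordinal.{u})).sum

/-- `cnfSum l` is the Cantor normal form of a multiple of `ω`: the exponents are decreasing and
positive, the coefficients are positive. -/
structure IsLimitCNF (l : List (Ordinal.{u} × ℕ)) : Prop where
  pairwise : l.Pairwise fun x y => y.1 < x.1
  exponent_ne_zero : ∀ x ∈ l, x.1 ≠ 0
  coeff_pos : ∀ x ∈ l, 1 ≤ x.2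

theorem cnfSum_cons (x : Ordinal.{u} × ℕ) (l : List (Ordinal.{u} × ℕ)) :
    cnfSum (x :: l) = ω ^ x.1 * x.2 + cnfSum l := by
  simp [cnfSum]

theorem IsLimitCNF.tail {x : Ordinal.{u} × ℕ} {l : List (Ordinal.{u} × ℕ)}
    (h : IsLimitCNF (x :: l)) : IsLimitCNF l :=
  ⟨h.pairwise.of_cons, fun y hy => h.exponent_ne_zero y (List.mem_cons_of_mem _ hy),
    fun y hy => h.coeff_pos y (List.mem_cons_of_mem _ hy)⟩

theorem opow_le_cnfSum {l : List (Ordinal.{u} × ℕ)} {x : Ordinal.{u} × ℕ} (hx : x ∈ l)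
    (hx2 : 1 ≤ x.2) : ω ^ x.1 ≤ cnfSum l := by
  have hone : (1 : Ordinal.{u}) ≤ x.2 := by exact_mod_cast hx2
  calc ω ^ x.1 ≤ ω ^ x.1 * x.2 := by simpa using mul_le_mul_right hone (ω ^ x.1)
    _ ≤ cnfSum l := List.le_sum_of_mem (List.mem_map_of_mem hx)

theorem cnfSum_lt_opow {l : List (Ordinal.{u} × ℕ)} {b : Ordinal.{u}} (hb : ∀ x ∈ l, x.1 < b) :
    cnfSum l < ω ^ b := by
  induction l with
  | nil => simpa [cnfSum] using opow_pos b omega0_pos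
  | cons x l ih =>
    rw [cnfSum_cons]
    refine isPrincipal_add_omega0_opow b ?_ (ih fun y hy => hb y (List.mem_cons_of_mem _ hy))
    calc ω ^ x.1 * (x.2 : Ordinal) < ω ^ x.1 * ω :=
          mul_lt_mul_of_pos_left (natCast_lt_omega0 _) (opow_pos _ omega0_pos)
      _ = ω ^ (x.1 + 1) := (opow_add_one _ _).symm
      _ ≤ ω ^ b := opow_le_opow_right omega0_pos (Order.add_one_le_of_lt (hb x (by simp)))

theorem IsLimitCNF.CNF_cnfSum {l : List (Ordinal.{u} × ℕ)} (hl : IsLimitCNF l) :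
    CNF ω (cnfSum l) = l.map fun x => (x.1, (x.2 : Ordinal.{u})) := by
  induction l with
  | nil => simp [cnfSum]
  | cons x l ih =>
    have hx : (x.2 : Ordinal) ≠ 0 := by
      exact_mod_cast (Nat.one_le_iff_ne_zero.1 (hl.coeff_pos x (by simp)))
    have hlt : cnfSum l < ω ^ x.1 := cnfSum_lt_opow (List.pairwise_cons.1 hl.pairwise).1
    rw [cnfSum_cons, CNF.opow_mul_add one_lt_omega0 hx (natCast_lt_omega0 _) hlt, ih hl.tail,
      List.map_cons]

theorem IsLimitCNF.cnfSum_injective {l l' : List (Ordinal.{u} × ℕ)} (hl : IsLimitCNF l)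
    (hl' : IsLimitCNF l') (h : cnfSum l = cnfSum l') : l = l' := by
  have hinj : Function.Injective fun x : Ordinal.{u} × ℕ => (x.1, (x.2 : Ordinal.{u})) := by
    rintro ⟨a, p⟩ ⟨b, q⟩ hab
    simpa using hab
  exact hinj.list_map (by rw [← hl.CNF_cnfSum, ← hl'.CNF_cnfSum, h])

theorem omega0_dvd_opow {a : Ordinal.{u}} (ha : a ≠ 0) : ω ∣ ω ^ a := by
  simpa using opow_dvd_opow ω (Order.one_le_iff_ne_zero.2 ha)

theorem IsLimitCNF.omega0_dvd_cnfSum {l : List (Ordinal.{u} × ℕ)} (hl : IsLimitCNF l) :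
    ω ∣ cnfSum l := by
  induction l with
  | nil => simp [cnfSum]
  | cons x l ih =>
    have hx := omega0_dvd_opow (hl.exponent_ne_zero x (by simp))
    rw [cnfSum_cons]
    exact (dvd_add_iff (hx.trans (dvd_mul_right _ _))).2 (ih hl.tail)

theorem exists_isLimitCNF {ξ : Ordinal.{u}} (hξ : ω ∣ ξ) : ∃ l, IsLimitCNF l ∧ cnfSum l = ξ := by
  induction ξ using CNF.rec ω with
  | H0 => exact ⟨[], ⟨List.Pairwise.nil, by simp, by simp⟩, by simp [cnfSum]⟩
  | H ξ h0 ih =>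
    have hlog : log ω ξ ≠ 0 := (log_pos one_lt_omega0 h0 (le_of_dvd h0 hξ)).ne'
    have hdvd : ω ∣ ξ % ω ^ log ω ξ := by
      rw [← div_add_mod ξ (ω ^ log ω ξ)] at hξ
      exact (dvd_add_iff ((omega0_dvd_opow hlog).trans (dvd_mul_right _ _))).1 hξ
    obtain ⟨l, hl, hsum⟩ := ih hdvd
    obtain ⟨p, hp⟩ := lt_omega0.1 (div_opow_log_lt ξ one_lt_omega0)
    have hp0 : 0 < ξ / ω ^ log ω ξ := div_opow_log_pos ω h0
    refine ⟨(log ω ξ, p) :: l, ⟨List.pairwise_cons.2 ⟨fun x hx => ?_, hl.pairwise⟩,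
      List.forall_mem_cons.2 ⟨hlog, hl.exponent_ne_zero⟩,
      List.forall_mem_cons.2 ⟨?_, hl.coeff_pos⟩⟩, ?_⟩
    · have hlt : ω ^ x.1 < ω ^ log ω ξ :=
        (opow_le_cnfSum hx (hl.coeff_pos x hx)).trans_lt
          (hsum ▸ mod_lt _ (opow_pos _ omega0_pos).ne')
      exact (opow_lt_opow_iff_right one_lt_omega0).1 hlt
    · rw [hp] at hp0
      exact_mod_cast hp0
    · rw [cnfSum_cons, hsum, ← hp, div_add_mod]

theorem IsLimitCNF.cnfSum_ne_opow {l : List (Ordinal.{u} × ℕ)} (hl : IsLimitCNF l)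
    (h2 : 2 ≤ (l.map Prod.snd).sum) {b : Ordinal.{u}} (hb : b ≠ 0) : cnfSum l ≠ ω ^ b := by
  intro h
  have hsingle : IsLimitCNF [(b, 1)] := ⟨List.pairwise_singleton _ _, by simpa, by simp⟩
  rw [hl.cnfSum_injective hsingle (by simpa [cnfSum] using h)] at h2
  simp at h2

theorem IsLimitCNF.isSuccLimit {l : List (Ordinal.{u} × ℕ)} (hl : IsLimitCNF l)
    (h2 : 2 ≤ (l.map Prod.snd).sum) : Order.IsSuccLimit (cnfSum l) := by
  refine isSuccLimit_iff.2 ⟨fun h => ?_, isSuccPrelimit_iff_omega0_dvd.2 hl.omega0_dvd_cnfSum⟩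
  have hnil : IsLimitCNF ([] : List (Ordinal.{u} × ℕ)) := ⟨List.Pairwise.nil, by simp, by simp⟩
  rw [hl.cnfSum_injective hnil (by simpa [cnfSum] using h)] at h2
  simp at h2

theorem IsLimitCNF.two_le_sum_coeff {l : List (Ordinal.{u} × ℕ)} (hl : IsLimitCNF l)
    (h0 : cnfSum l ≠ 0) (hpow : ∀ a : Ordinal.{u}, cnfSum l ≠ ω ^ a) :
    2 ≤ (l.map Prod.snd).sum := by
  rcases l with _ | ⟨x, _ | ⟨y, l⟩⟩
  · exact absurd rfl h0
  · by_contra! h2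
    have hx2 : x.2 = 1 := by
      have hpos := hl.coeff_pos x (by simp)
      simp only [List.map_cons, List.map_nil, List.sum_cons, List.sum_nil] at h2
      omega
    exact hpow x.1 (by simp [cnfSum, hx2])
  · have hx := hl.coeff_pos x (by simp)
    have hy := hl.coeff_pos y (by simp)
    simp only [List.map_cons, List.sum_cons]
    omega

theorem isSuccLimit_omega0_opow {b : Ordinal.{u}} (hb : b ≠ 0) : Order.IsSuccLimit (ω ^ b) :=
  isSuccLimit_opow_left isSuccLimit_omega0 hb

theorem not_isSuccLimit_add_one (ζ : Ordinal.{u}) : ¬ Order.IsSuccLimit (ζ + 1) :=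
  fun h => h.succ_ne ζ rfl

theorem eventually_le_opow_mul {a : Ordinal.{u}} (ha : a ≠ 0) {b : ℕ → Ordinal.{u}}
    (hb : ∀ c < a, ∀ᶠ n in atTop, c ≤ b n) {γ : Ordinal.{u}} (hγ : γ < ω ^ a) :
    ∀ᶠ n : ℕ in atTop, γ ≤ ω ^ b (n + 1) * n := by
  obtain ⟨c, hc, k, hγk⟩ := (lt_omega0_opow ha).1 hγ
  filter_upwards [(tendsto_add_atTop_nat 1).eventually (hb c hc), eventually_ge_atTop k]
    with n hcn hkn
  calc γ ≤ ω ^ c * k := hγk.le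
    _ ≤ ω ^ b (n + 1) * n :=
      mul_le_mul' (opow_le_opow_right omega0_pos hcn) (by exact_mod_cast hkn)

theorem pow_induction_mul {M : Type*} [Monoid M] {p : Ordinal.{u} → M → Prop} (zero : p 0 1)
    (mul : ∀ β γ B C, p β B → p γ C → p (β + γ) (B * C)) {β : Ordinal.{u}}
    {B : M} (h : p β B) (n : ℕ) : p (β * n) (B ^ n) := by
  induction n with
  | zero => simpa using zero
  | succ n ih => simpa [pow_succ, mul_add_one] using mul _ _ _ _ ih h

end CantorNormalForm

section SchreierFamilies

attribute [local instance] concatMonoid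

variable {lam : Ordinal.{0} → ℕ → Ordinal.{0}}

theorem Schreier.mem_finSub {ξ : Ordinal.{0}} {s : Finset ℕ} (h : Schreier lam ξ s) :
    s ∈ finSub := by
  induction h with
  | zero => simp [finSub]
  | succ _ _ _ hn _ _ ih => exact Finset.forall_mem_insert _ _ _ |>.2 ⟨hn, ih⟩
  | opow_succ _ _ _ _ _ _ ih =>
    intro x hx
    obtain ⟨i, -, hi⟩ := Finset.mem_biUnion.1 hx
    exact ih i x hi
  | opow_limit _ _ _ _ _ _ ih => exact ih
  | limit _ _ _ _ _ _ _ _ _ _ _ ih =>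
    intro x hx
    obtain ⟨i, -, hi⟩ := Finset.mem_biUnion.1 hx
    obtain ⟨j, -, hj⟩ := Finset.mem_biUnion.1 hi
    exact ih i j x hj

variable (lam) in
/-- The product of the families attached to the summands of `cnfSum l`. -/
def cnfProd (l : List (Ordinal.{0} × ℕ)) : Set (Finset ℕ) :=
  (l.map fun x => schreierFamily lam (ω ^ x.1) ^ x.2).prod

theorem mem_cnfProd_ofFn {k : ℕ} {a : Fin k → Ordinal.{0}} {p : Fin k → ℕ} {s : Finset ℕ} :
    s ∈ cnfProd lam (List.ofFn fun i => (a i, p i)) ↔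
      ∃ t : (i : Fin k) → Fin (p i) → Finset ℕ, (∀ i j, Schreier lam (ω ^ a i) (t i j)) ∧
        (∀ i j j', j < j' → BlockLT (t i j) (t i j')) ∧
        (∀ i i', i < i' → ∀ j j', BlockLT (t i' j') (t i j)) ∧
        (Finset.univ.biUnion fun i => Finset.univ.biUnion (t i)) = s := by
  have hlt {m n : ℕ} (u : Fin m → Finset ℕ) (v : Fin n → Finset ℕ) :
      BlockLT (Finset.univ.biUnion u) (Finset.univ.biUnion v) ↔
        ∀ j' j, BlockLT (u j) (v j') := by
    simp only [BlockLT, Finset.mem_biUnion, Finset.mem_univ, true_and]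
    exact ⟨fun h j' j x hx y hy => h x ⟨j, hx⟩ y ⟨j', hy⟩,
      fun h x ⟨j, hx⟩ y ⟨j', hy⟩ => h j' j x hx y hy⟩
  rw [cnfProd, List.map_ofFn, mem_prod_ofFn]
  constructor
  · rintro ⟨T, hT, hTlt, rfl⟩
    choose t ht hlt' htT using fun i => mem_pow.1 (hT i)
    obtain rfl : (fun i => Finset.univ.biUnion (t i)) = T := funext htT
    exact ⟨t, ht, hlt', fun i i' h => (hlt _ _).1 (hTlt i i' h), rfl⟩
  · rintro ⟨t, ht, hlt', hTlt, rfl⟩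
    exact ⟨_, fun i => mem_pow.2 ⟨t i, ht i, hlt' i, rfl⟩,
      fun i i' h => (hlt _ _).2 (hTlt i i' h), rfl⟩

theorem schreier_cases {ξ : Ordinal.{0}} {s : Finset ℕ} (h : Schreier lam ξ s) :
    (ξ = 0 ∧ s = ∅) ∨
    (∃ ζ, ξ = ζ + 1 ∧ s ∈ schreierFamily lam ζ * singletons) ∨
    (∃ β : Ordinal.{0}, ξ = ω ^ (β + 1) ∧
      s ∈ diagonal fun n => schreierFamily lam (ω ^ β) ^ n) ∨
    (∃ l : Ordinal.{0}, Order.IsSuccLimit l ∧ ξ = ω ^ l ∧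
      s ∈ diagonal fun n => schreierFamily lam (ω ^ lam l n)) ∨
    (∃ l, IsLimitCNF l ∧ 2 ≤ (l.map Prod.snd).sum ∧ ξ = cnfSum l ∧ s ∈ cnfProd lam l) := by
  have hpos := h.mem_finSub
  cases h with
  | zero => exact .inl ⟨rfl, rfl⟩
  | succ ζ n s hn hns hs => exact .inr (.inl ⟨ζ, rfl, s, hs, {n}, ⟨n, hn, rfl⟩, hns, rfl⟩)
  | opow_succ β n t ht hlt hmin =>
    exact .inr (.inr (.inl ⟨β, rfl, n, hpos n hmin.1, hmin, mem_pow.2 ⟨t, ht, hlt, rfl⟩⟩))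
  | opow_limit l hl n s hmin hs =>
    exact .inr (.inr (.inr (.inl ⟨l, hl, rfl, n, hpos n hmin.1, hmin, hs⟩)))
  | limit m a p ha ha0 hp hmp t ht hlt hlt' =>
    refine .inr (.inr (.inr (.inr ⟨List.ofFn fun i => (a i, p i), ⟨?_, ?_, ?_⟩, ?_, ?_,
      mem_cnfProd_ofFn.2 ⟨t, ht, hlt, hlt', rfl⟩⟩)))
    · exact List.pairwise_ofFn.2 fun i j hij => ha hij
    · exact List.forall_mem_ofFn_iff.2 fun i => (ha0 i).ne'
    · exact List.forall_mem_ofFn_iff.2 hp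
    · rw [List.map_ofFn, List.sum_ofFn]
      have hle : m + 1 ≤ ∑ i, p i := by
        simpa using Finset.card_nsmul_le_sum Finset.univ p 1 fun i _ => hp i
      have h0 : p 0 ≤ ∑ i, p i := Finset.single_le_sum (by simp) (Finset.mem_univ _)
      simp only [Function.comp_def]
      omega
    · rw [cnfSum, List.map_ofFn]
      rfl

theorem schreierFamily_zero : schreierFamily lam 0 = 1 := by
  ext s
  refine ⟨fun h => ?_, fun h => mem_one.1 h ▸ Schreier.zero⟩
  rcases schreier_cases h with
    ⟨-, hs⟩ | ⟨ζ, h, -⟩ | ⟨β, h, -⟩ | ⟨l, -, h, -⟩ | ⟨l, hl, h2, h, -⟩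
  · exact hs
  · exact absurd h.symm (by simp)
  · exact absurd h.symm (opow_pos _ omega0_pos).ne'
  · exact absurd h.symm (opow_pos _ omega0_pos).ne'
  · exact absurd h.symm (hl.isSuccLimit h2).bot_lt.ne'

theorem schreierFamily_add_one (ζ : Ordinal.{0}) :
    schreierFamily lam (ζ + 1) = schreierFamily lam ζ * singletons := by
  ext s
  refine ⟨fun h => ?_, ?_⟩
  · rcases schreier_cases h with
      ⟨h, -⟩ | ⟨ζ', h, hs⟩ | ⟨β, h, -⟩ | ⟨l, hl, h, -⟩ | ⟨l, hl, h2, h, -⟩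
    · exact absurd h (by simp)
    · rwa [Order.add_one_inj.1 h]
    · exact absurd (h ▸ isSuccLimit_omega0_opow (by simp)) (not_isSuccLimit_add_one ζ)
    · exact absurd (h ▸ isSuccLimit_omega0_opow hl.bot_lt.ne') (not_isSuccLimit_add_one ζ)
    · exact absurd (h ▸ hl.isSuccLimit h2) (not_isSuccLimit_add_one ζ)
  · rintro ⟨t, ht, _, ⟨n, hn, rfl⟩, hnt, rfl⟩
    exact Schreier.succ ζ n t hn hnt ht

theorem schreierFamily_opow_add_one (β : Ordinal.{0}) :
    schreierFamily lam (ω ^ (β + 1)) = diagonal fun n => schreierFamily lam (ω ^ β) ^ n := by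
  have hlim : Order.IsSuccLimit (ω ^ (β + 1)) := isSuccLimit_omega0_opow (by simp)
  ext s
  refine ⟨fun h => ?_, ?_⟩
  · rcases schreier_cases h with
      ⟨h, -⟩ | ⟨ζ, h, -⟩ | ⟨β', h, hs⟩ | ⟨l, hl, h, -⟩ | ⟨l, hl, h2, h, -⟩
    · exact absurd h hlim.bot_lt.ne'
    · exact absurd (h ▸ hlim) (not_isSuccLimit_add_one ζ)
    · rwa [Order.add_one_inj.1 ((opow_right_inj one_lt_omega0).1 h)]
    · exact absurd ((opow_right_inj one_lt_omega0).1 h ▸ hl) (not_isSuccLimit_add_one β)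
    · exact absurd h.symm (hl.cnfSum_ne_opow h2 (by simp))
  · rintro ⟨n, -, hn, h⟩
    obtain ⟨t, ht, hlt, rfl⟩ := mem_pow.1 h
    exact Schreier.opow_succ β n t ht hlt hn

theorem schreierFamily_opow_limit {l : Ordinal.{0}} (hl : Order.IsSuccLimit l) :
    schreierFamily lam (ω ^ l) = diagonal fun n => schreierFamily lam (ω ^ lam l n) := by
  have hlim : Order.IsSuccLimit (ω ^ l) := isSuccLimit_omega0_opow hl.bot_lt.ne'
  ext s
  refine ⟨fun h => ?_, fun ⟨n, _, hn, h⟩ => Schreier.opow_limit l hl n s hn h⟩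
  rcases schreier_cases h with
    ⟨h, -⟩ | ⟨ζ, h, -⟩ | ⟨β, h, -⟩ | ⟨l', -, h, hs⟩ | ⟨l', hl', h2, h, -⟩
  · exact absurd h hlim.bot_lt.ne'
  · exact absurd (h ▸ hlim) (not_isSuccLimit_add_one ζ)
  · exact absurd ((opow_right_inj one_lt_omega0).1 h ▸ hl) (not_isSuccLimit_add_one β)
  · rwa [(opow_right_inj one_lt_omega0).1 h]
  · exact absurd h.symm (hl'.cnfSum_ne_opow h2 hl.bot_lt.ne')

theorem schreierFamily_cnfSum {l : List (Ordinal.{0} × ℕ)} (hl : IsLimitCNF l)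
    (h2 : 2 ≤ (l.map Prod.snd).sum) : schreierFamily lam (cnfSum l) = cnfProd lam l := by
  have hlim := hl.isSuccLimit h2
  ext s
  constructor
  · intro h
    rcases schreier_cases h with
      ⟨h, -⟩ | ⟨ζ, h, -⟩ | ⟨β, h, -⟩ | ⟨l', hl', h, -⟩ | ⟨l', hl', -, h, hs⟩
    · exact absurd h hlim.bot_lt.ne'
    · exact absurd (h ▸ hlim) (not_isSuccLimit_add_one ζ)
    · exact absurd h (hl.cnfSum_ne_opow h2 (by simp))
    · exact absurd h (hl.cnfSum_ne_opow h2 hl'.bot_lt.ne')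
    · rwa [hl.cnfSum_injective hl' h]
  · intro h
    obtain ⟨m, f, rfl⟩ : ∃ (m : ℕ) (f : Fin (m + 1) → Ordinal.{0} × ℕ), l = List.ofFn f := by
      obtain ⟨⟨_ | m, f⟩, rfl⟩ := List.equivSigmaTuple.symm.surjective l
      · simp [List.equivSigmaTuple] at h2
      · exact ⟨m, f, rfl⟩
    obtain ⟨t, ht, hlt, hlt', rfl⟩ := mem_cnfProd_ofFn.1 h
    have key := Schreier.limit (lam := lam) m (fun i => (f i).1) (fun i => (f i).2)
      (fun i j hij => List.pairwise_ofFn.1 hl.pairwise hij)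
      (fun i => pos_iff_ne_zero.2 (List.forall_mem_ofFn_iff.1 hl.exponent_ne_zero i))
      (fun i => List.forall_mem_ofFn_iff.1 hl.coeff_pos i) ?_ t ht hlt hlt'
    · rwa [cnfSum, List.map_ofFn]
    · by_contra! hmp
      obtain rfl : m = 0 := by omega
      have hsum : ((List.ofFn f).map Prod.snd).sum = (f 0).2 := by simp
      omega

/-- For limit `a` the terms of the chosen sequence are successors, and the two diagonalizations
collapse into one. -/
theorem exists_schreierFamily_opow_eq_diagonal (hlam : IsLimitChoice lam) {a : Ordinal.{0}}
    (ha0 : a ≠ 0) (ha : a < ω₁) :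
    ∃ b : ℕ → Ordinal.{0}, (∀ n, 1 ≤ n → b n < a) ∧ (∀ c < a, ∀ᶠ n in atTop, c ≤ b n) ∧
      schreierFamily lam (ω ^ a) = diagonal fun n => schreierFamily lam (ω ^ b n) ^ n := by
  rcases zero_or_succ_or_isSuccLimit a with rfl | ⟨β, rfl⟩ | hlim
  · exact absurd rfl ha0
  · exact ⟨fun _ => β, fun _ _ => Order.lt_add_one_iff.2 le_rfl,
      fun c hc => .of_forall fun _ => Order.lt_add_one_iff.1 hc, schreierFamily_opow_add_one β⟩
  · obtain ⟨hmono, hsucc, hlub⟩ := hlam a hlim ha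
    choose! b hb using fun n hn => (hsucc n hn).1
    refine ⟨b, fun n hn => ?_, fun c hc => ?_, ?_⟩
    · exact (Order.lt_add_one_iff.2 le_rfl).trans (hb n hn ▸ (hsucc n hn).2)
    · obtain ⟨_, ⟨m, hm, rfl⟩, hcm⟩ := (lt_isLUB_iff hlub).1 hc
      filter_upwards [eventually_ge_atTop m] with n hmn
      have hn : 1 ≤ n := le_trans hm hmn
      exact Order.lt_add_one_iff.1 (hb n hn ▸ hcm.trans_le (hmono.monotoneOn hm hn hmn))
    · calc schreierFamily lam (ω ^ a)
          = diagonal fun n => diagonal fun k => schreierFamily lam (ω ^ b n) ^ k := by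
            rw [schreierFamily_opow_limit hlim]
            exact diagonal_congr fun n hn => by rw [hb n hn, schreierFamily_opow_add_one]
        _ = diagonal fun n => schreierFamily lam (ω ^ b n) ^ n := diagonal_diagonal _

theorem cnfProd_induction {p : Ordinal.{0} → Set (Finset ℕ) → Prop} (zero : p 0 1)
    (mul : ∀ β γ B C, p β B → p γ C → p (β + γ) (B * C)) {l : List (Ordinal.{0} × ℕ)}
    (h : ∀ x ∈ l, p (ω ^ x.1) (schreierFamily lam (ω ^ x.1))) :
    p (cnfSum l) (cnfProd lam l) := by
  induction l with
  | nil => simpa [cnfSum, cnfProd] using zero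
  | cons x l ih =>
    rw [cnfSum_cons, cnfProd, List.map_cons, List.prod_cons]
    exact mul _ _ _ _ (pow_induction_mul zero mul (h x (by simp)) x.2)
      (ih fun y hy => h y (List.mem_cons_of_mem _ hy))

theorem schreierFamily_induction (hlam : IsLimitChoice lam)
    {p : Ordinal.{0} → Set (Finset ℕ) → Prop} (zero : p 0 1) (one : p 1 singletons)
    (mul : ∀ β γ B C, p β B → p γ C → p (β + γ) (B * C))
    (diag : ∀ a ≠ 0, ∀ (b : ℕ → Ordinal.{0}) (𝓑 : ℕ → Set (Finset ℕ)),
      (∀ c < a, ∀ᶠ n in atTop, c ≤ b n) → (∀ n, 1 ≤ n → p (ω ^ b n) (𝓑 n)) →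
        p (ω ^ a) (diagonal fun n => 𝓑 n ^ n))
    {ξ : Ordinal.{0}} (hξ : ξ < ω₁) : p ξ (schreierFamily lam ξ) := by
  induction ξ using WellFoundedLT.induction with
  | _ ξ ih =>
  rcases zero_or_succ_or_isSuccLimit ξ with rfl | ⟨ζ, rfl⟩ | hlim
  · rwa [schreierFamily_zero]
  · have hζ : ζ < ζ + 1 := Order.lt_add_one_iff.2 le_rfl
    change p (ζ + 1) (schreierFamily lam (ζ + 1))
    rw [schreierFamily_add_one]
    exact mul _ _ _ _ (ih ζ hζ (hζ.trans hξ)) one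
  by_cases hpow : ∃ a : Ordinal.{0}, ξ = ω ^ a
  · obtain ⟨a, rfl⟩ := hpow
    have ha0 : a ≠ 0 := by
      rintro rfl
      exact not_isSuccLimit_add_one 0 (by simpa using hlim)
    obtain ⟨b, hba, hcof, heq⟩ := exists_schreierFamily_opow_eq_diagonal hlam ha0
      ((right_le_opow a one_lt_omega0).trans_lt hξ)
    rw [heq]
    refine diag a ha0 b _ hcof fun n hn => ?_
    have hlt : ω ^ b n < ω ^ a := (opow_lt_opow_iff_right one_lt_omega0).2 (hba n hn)
    exact ih _ hlt (hlt.trans hξ)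
  · obtain ⟨l, hl, rfl⟩ := exists_isLimitCNF (isSuccPrelimit_iff_omega0_dvd.1 hlim.isSuccPrelimit)
    have h2 := hl.two_le_sum_coeff hlim.bot_lt.ne' fun a h => hpow ⟨a, h⟩
    rw [schreierFamily_cnfSum hl h2]
    refine cnfProd_induction zero mul fun x hx => ?_
    have hlt : ω ^ x.1 < cnfSum l :=
      (opow_le_cnfSum hx (hl.coeff_pos x hx)).lt_of_ne fun h => hpow ⟨_, h.symm⟩
    exact ih _ hlt (hlt.trans hξ)

end SchreierFamilies

section ThinFamilies

attribute [local instance] concatMonoid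

/-- A family is thin if no member is a proper initial segment of another one. -/
def IsThin (B : Set (Finset ℕ)) : Prop := ∀ s ∈ B, ∀ t ∈ B, IsInitialSegment t s → t = s

theorem isInitialSegment_union_left {s t : Finset ℕ} (h : BlockLT s t) :
    IsInitialSegment s (s ∪ t) := by
  refine ⟨Finset.subset_union_left, fun x hx y hy hyx => ?_⟩
  rcases Finset.mem_union.1 hy with hy | hy
  · exact hy
  · exact absurd hyx (h x hx y hy).not_ge

theorem IsInitialSegment.trans {s t u : Finset ℕ} (h : IsInitialSegment s t)
    (h' : IsInitialSegment t u) : IsInitialSegment s u :=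
  ⟨h.1.trans h'.1, fun x hx y hy hyx => h.2 x hx y (h'.2 x (h.1 hx) y hy hyx) hyx⟩

theorem IsInitialSegment.of_subset {s t u : Finset ℕ} (h : IsInitialSegment s u) (hst : s ⊆ t)
    (htu : t ⊆ u) : IsInitialSegment s t :=
  ⟨hst, fun x hx y hy hyx => h.2 x hx y (htu hy) hyx⟩

theorem IsInitialSegment.comparable {s t u : Finset ℕ} (h : IsInitialSegment s u)
    (h' : IsInitialSegment t u) : IsInitialSegment s t ∨ IsInitialSegment t s := by
  by_cases hst : s ⊆ t
  · exact .inl (h.of_subset hst h'.1)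
  · refine .inr (h'.of_subset (fun y hy => ?_) h.1)
    obtain ⟨x, hx, hxt⟩ := Finset.not_subset.1 hst
    rcases le_total y x with hyx | hxy
    · exact h.2 x hx y (h'.1 hy) hyx
    · exact absurd (h'.2 y hy x (h.1 hx) hxy) hxt

theorem IsInitialSegment.eq_of_isLeast {s t : Finset ℕ} (h : IsInitialSegment t s) {n m : ℕ}
    (hn : IsLeast (↑s : Set ℕ) n) (hm : IsLeast (↑t : Set ℕ) m) : m = n :=
  le_antisymm (hm.2 (h.2 m hm.1 n hn.1 (hn.2 (h.1 hm.1)))) (hn.2 (h.1 hm.1))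

theorem isInitialSegment_of_prefix {v w : List ℕ} (hw : w.Pairwise (· < ·)) (h : v <+: w) :
    IsInitialSegment v.toFinset w.toFinset := by
  obtain ⟨u, rfl⟩ := h
  rw [List.toFinset_append]
  refine isInitialSegment_union_left fun x hx y hy => ?_
  exact (List.pairwise_append.1 hw).2.2 x (List.mem_toFinset.1 hx) y (List.mem_toFinset.1 hy)

theorem IsThin.eq_of_isInitialSegment {B : Set (Finset ℕ)} (hB : IsThin B) {s t u : Finset ℕ}
    (hs : s ∈ B) (ht : t ∈ B) (h : IsInitialSegment s u) (h' : IsInitialSegment t u) : s = t := by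
  rcases h.comparable h' with h | h
  · exact hB t ht s hs h
  · exact (hB s hs t ht h).symm

theorem IsThin.eq_of_prefix {B : Set (Finset ℕ)} (hB : IsThin B) {v w : List ℕ}
    (hv : v ∈ tuples B) (hw : w ∈ tuples B) (h : v <+: w) : v = w := by
  have heq := hB _ hw.2 _ hv.2 (isInitialSegment_of_prefix hw.1 h)
  refine h.eq_of_length ?_
  rw [← List.toFinset_card_of_nodup hv.1.nodup, ← List.toFinset_card_of_nodup hw.1.nodup, heq]

theorem isThin_one : IsThin 1 := by
  rintro _ rfl _ rfl -
  rfl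

theorem isThin_singletons : IsThin singletons := by
  rintro _ ⟨n, -, rfl⟩ _ ⟨m, -, rfl⟩ h
  simpa using h.1

theorem IsThin.mul {B C : Set (Finset ℕ)} (hB : IsThin B) (hC : IsThin C) :
    IsThin (B * C) := by
  rintro _ ⟨t, ht, s, hs, hst, rfl⟩ _ ⟨t', ht', s', hs', hst', rfl⟩ h
  obtain rfl : s' = s := hC.eq_of_isInitialSegment hs' hs
    ((isInitialSegment_union_left hst').trans h) (isInitialSegment_union_left hst)
  have hcancel {x : ℕ} {a b : Finset ℕ} (ha : BlockLT s' a) (hx : x ∈ a) (hxb : x ∈ s' ∪ b) :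
      x ∈ b :=
    (Finset.mem_union.1 hxb).resolve_left fun hxs => lt_irrefl x (ha x hxs x hx)
  have htt' : IsInitialSegment t' t :=
    ⟨fun x hx => hcancel hst' hx (h.1 (Finset.mem_union_right _ hx)),
      fun x hx y hy hyx => hcancel hst hy
        (h.2 x (Finset.mem_union_right _ hx) y (Finset.mem_union_right _ hy) hyx)⟩
  rw [hB t ht t' ht' htt']

theorem IsThin.pow {B : Set (Finset ℕ)} (hB : IsThin B) (n : ℕ) : IsThin (B ^ n) :=
  pow_induction_mul (p := fun _ : Ordinal.{0} => IsThin) (β := 0) isThin_one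
    (fun _ _ _ _ => IsThin.mul) hB n

theorem isThin_diagonal {𝓑 : ℕ → Set (Finset ℕ)} (h : ∀ n, 1 ≤ n → IsThin (𝓑 n)) :
    IsThin (diagonal 𝓑) := by
  rintro s ⟨n, hn, hsn, hs⟩ t ⟨m, -, htm, ht⟩ hts
  obtain rfl := hts.eq_of_isLeast hsn htm
  exact h m hn s hs t ht hts

theorem isThin_schreierFamily {lam : Ordinal.{0} → ℕ → Ordinal.{0}} (hlam : IsLimitChoice lam)
    {ξ : Ordinal.{0}} (hξ : ξ < ω₁) : IsThin (schreierFamily lam ξ) :=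
  schreierFamily_induction (p := fun _ => IsThin) hlam isThin_one isThin_singletons
    (fun _ _ _ _ => IsThin.mul)
    (fun _ _ _ _ _ h => isThin_diagonal fun n hn => (h n hn).pow n) hξ

end ThinFamilies

section RankOfFamilies

attribute [local instance] concatMonoid

/-- The tree of initial segments of the members of `B` inside `M`, as tuples. -/
def treeOn (B : Set (Finset ℕ)) (M : Set ℕ) : Set (List ℕ) :=
  {w | ∃ v ∈ tuples B, (∀ x ∈ v, x ∈ M) ∧ w <+: v}

/-- Inside every infinite `M` each positive `n ∈ M` is the minimum of a member of `B`. -/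
def HasAllMins (B : Set (Finset ℕ)) : Prop :=
  ∀ M : Set ℕ, M.Infinite → ∀ n ∈ M, 1 ≤ n → ∃ v, n :: v ∈ tuples B ∧ ∀ x ∈ n :: v, x ∈ M

/-- The trees `treeOn B M` have rank at least `β` for all infinite `M`. The second condition is an
invariant which carries this property through diagonalizations. -/
structure IsHereditarilyRanked (β : Ordinal.{0}) (B : Set (Finset ℕ)) : Prop where
  hasRankGE : ∀ M : Set ℕ, M.Infinite → HasRankGE (treeOn B M) β []
  eq_one_or_hasAllMins : β = 0 ∧ B = 1 ∨ HasAllMins B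

theorem isPrefixClosed_treeOn (B : Set (Finset ℕ)) (M : Set ℕ) : IsPrefixClosed (treeOn B M) :=
  fun _ _ hvw ⟨u, hu, huM, hwu⟩ => ⟨u, hu, huM, hvw.trans hwu⟩

theorem append_mem_tuples_mul {B C : Set (Finset ℕ)} {v w : List ℕ} (hv : v ∈ tuples C)
    (hw : w ∈ tuples B) (hvw : ∀ x ∈ v, ∀ y ∈ w, x < y) : v ++ w ∈ tuples (B * C) := by
  refine ⟨List.pairwise_append.2 ⟨hv.1, hw.1, hvw⟩, w.toFinset, hw.2, v.toFinset, hv.2, ?_, ?_⟩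
  · simpa [BlockLT] using hvw
  · rw [List.toFinset_append]

theorem infinite_sep_forall_lt {M : Set ℕ} (hM : M.Infinite) (v : List ℕ) :
    {m ∈ M | ∀ x ∈ v, x < m}.Infinite := by
  have hev : ∀ᶠ m in atTop, ∀ x ∈ v, x < m := by
    simpa using (eventually_all_finset v.toFinset).2 fun x _ => eventually_gt_atTop x
  exact Nat.frequently_atTop_iff_infinite.1
    ((Nat.frequently_atTop_iff_infinite.2 hM).and_eventually hev)

theorem hasRankGE_treeOn_of_append {β : Ordinal.{0}} {B D : Set (Finset ℕ)}
    (hB : ∀ M : Set ℕ, M.Infinite → HasRankGE (treeOn B M) β []) {M : Set ℕ} (hM : M.Infinite)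
    {v : List ℕ} (hvM : ∀ x ∈ v, x ∈ M)
    (hD : ∀ w ∈ tuples B, (∀ x ∈ v, ∀ y ∈ w, x < y) → v ++ w ∈ tuples D) :
    HasRankGE (treeOn D M) β v := by
  have hrank := (hB _ (infinite_sep_forall_lt hM v)).map (f := (v ++ ·)) (T' := treeOn D M)
    (fun w x => ⟨x, (List.append_assoc v w [x]).symm⟩) ?_
  · simpa using hrank
  · rintro w ⟨u, hu, huM, hwu⟩
    exact ⟨v ++ u, hD u hu fun x hx y hy => (huM y hy).2 x hx,
      List.forall_mem_append.2 ⟨hvM, fun x hx => (huM x hx).1⟩,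
      (List.prefix_append_right_inj v).2 hwu⟩

theorem HasAllMins.mul_right {B C : Set (Finset ℕ)} (hC : HasAllMins C)
    (hB : ∀ M : Set ℕ, M.Infinite → [] ∈ treeOn B M) : HasAllMins (B * C) := by
  intro M hM n hn hn1
  obtain ⟨v, hv, hvM⟩ := hC M hM n hn hn1
  obtain ⟨w, hw, hwM, -⟩ := hB _ (infinite_sep_forall_lt hM (n :: v))
  exact ⟨v ++ w, append_mem_tuples_mul hv hw fun x hx y hy => (hwM y hy).2 x hx,
    List.forall_mem_append.2 ⟨hvM, fun x hx => (hwM x hx).1⟩⟩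

theorem IsHereditarilyRanked.mul {β γ : Ordinal.{0}} {B C : Set (Finset ℕ)}
    (hB : IsHereditarilyRanked β B) (hC : IsHereditarilyRanked γ C) :
    IsHereditarilyRanked (β + γ) (B * C) where
  hasRankGE M hM := by
    refine HasRankGE.add (fun w hw => ?_) (hC.hasRankGE M hM)
    obtain ⟨v, hv, hvM, hwv⟩ := hw
    exact (hasRankGE_treeOn_of_append hB.hasRankGE hM hvM fun u hu hvu =>
      append_mem_tuples_mul hv hu hvu).of_prefix (isPrefixClosed_treeOn _ _) hwv
  eq_one_or_hasAllMins := by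
    rcases hC.eq_one_or_hasAllMins with ⟨rfl, rfl⟩ | hC
    · simpa using hB.eq_one_or_hasAllMins
    · exact .inr (hC.mul_right fun M hM => (hB.hasRankGE M hM).mem)

theorem isHereditarilyRanked_one : IsHereditarilyRanked 0 1 where
  hasRankGE _ _ := hasRankGE_iff.2
    ⟨⟨[], ⟨List.Pairwise.nil, rfl⟩, by simp, List.prefix_rfl⟩, fun _ h => absurd h (by simp)⟩
  eq_one_or_hasAllMins := .inl ⟨rfl, rfl⟩

theorem hasAllMins_singletons : HasAllMins singletons := fun _ _ n hn hn1 =>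
  ⟨[], ⟨List.pairwise_singleton _ _, n, hn1, rfl⟩, by simpa using hn⟩

theorem isHereditarilyRanked_singletons : IsHereditarilyRanked 1 singletons where
  hasRankGE M hM := by
    obtain ⟨n, hn, hn1⟩ := hM.exists_gt 0
    obtain ⟨v, hv, hvM⟩ := hasAllMins_singletons M hM n hn hn1
    refine hasRankGE_iff.2 ⟨⟨n :: v, hv, hvM, List.nil_prefix⟩, fun β hβ => ⟨n, ?_⟩⟩
    obtain rfl := Order.lt_one_iff.1 hβ
    exact hasRankGE_iff.2 ⟨⟨n :: v, hv, hvM, List.prefix_append [n] v⟩,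
      fun _ h => absurd h (by simp)⟩
  eq_one_or_hasAllMins := .inr hasAllMins_singletons

theorem IsHereditarilyRanked.pow {β : Ordinal.{0}} {B : Set (Finset ℕ)}
    (h : IsHereditarilyRanked β B) (n : ℕ) : IsHereditarilyRanked (β * n) (B ^ n) :=
  pow_induction_mul isHereditarilyRanked_one (fun _ _ _ _ => IsHereditarilyRanked.mul) h n

theorem IsHereditarilyRanked.hasAllMins {β : Ordinal.{0}} {B : Set (Finset ℕ)}
    (h : IsHereditarilyRanked β B) (hβ : β ≠ 0) : HasAllMins B :=
  h.eq_one_or_hasAllMins.resolve_left fun h => hβ h.1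

theorem cons_mem_tuples_diagonal {𝓑 : ℕ → Set (Finset ℕ)} {n : ℕ} (hn : 1 ≤ n) {v : List ℕ}
    (h : n :: v ∈ tuples (𝓑 n)) : n :: v ∈ tuples (diagonal 𝓑) := by
  refine ⟨h.1, n, hn, ⟨by simp, fun x hx => ?_⟩, h.2⟩
  rcases List.mem_cons.1 (List.mem_toFinset.1 hx) with rfl | hx
  · exact le_rfl
  · exact ((List.pairwise_cons.1 h.1).1 x hx).le

theorem hasAllMins_diagonal {𝓑 : ℕ → Set (Finset ℕ)} (h : ∀ n, 1 ≤ n → HasAllMins (𝓑 n)) :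
    HasAllMins (diagonal 𝓑) := fun M hM n hn hn1 =>
  (h n hn1 M hM n hn hn1).imp fun _ hv => ⟨cons_mem_tuples_diagonal hn1 hv.1, hv.2⟩

theorem isHereditarilyRanked_diagonal {a : Ordinal.{0}} (ha : a ≠ 0) {b : ℕ → Ordinal.{0}}
    {𝓑 : ℕ → Set (Finset ℕ)} (hb : ∀ c < a, ∀ᶠ n in atTop, c ≤ b n)
    (h : ∀ n, 1 ≤ n → IsHereditarilyRanked (ω ^ b n) (𝓑 n)) :
    IsHereditarilyRanked (ω ^ a) (diagonal fun n => 𝓑 n ^ n) where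
  hasRankGE M hM := by
    refine hasRankGE_of_isSuccLimit (isSuccLimit_omega0_opow ha) fun γ hγ => ?_
    obtain ⟨N, hN⟩ := eventually_atTop.1 (eventually_le_opow_mul ha hb hγ)
    obtain ⟨m, hm, hNm⟩ := hM.exists_gt N
    obtain ⟨n, rfl⟩ : ∃ n, m = n + 1 := ⟨m - 1, by omega⟩
    have hn : 1 ≤ n + 1 := by omega
    -- The first of the `n + 1` blocks fixes the minimum, the remaining `n` blocks carry the rank.
    obtain ⟨v, hv, hvM⟩ := (h _ hn).hasAllMins (opow_pos _ omega0_pos).ne' M hM _ hm hn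
    have hrank : HasRankGE (treeOn (diagonal fun n => 𝓑 n ^ n) M) (ω ^ b (n + 1) * n)
        ((n + 1) :: v) :=
      hasRankGE_treeOn_of_append ((h _ hn).pow n).hasRankGE hM hvM fun w hw hvw =>
        cons_mem_tuples_diagonal hn (pow_succ (𝓑 (n + 1)) n ▸ append_mem_tuples_mul hv hw hvw)
    exact (hrank.mono (hN n (by omega))).of_prefix (isPrefixClosed_treeOn _ _) List.nil_prefix
  eq_one_or_hasAllMins := by
    refine .inr (hasAllMins_diagonal fun n hn => ((h n hn).pow n).hasAllMins ?_)
    exact mul_ne_zero (opow_pos _ omega0_pos).ne' (by exact_mod_cast (by omega : n ≠ 0))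

theorem hasRankGE_treeOn_schreierFamily {lam : Ordinal.{0} → ℕ → Ordinal.{0}}
    (hlam : IsLimitChoice lam) {ξ : Ordinal.{0}} (hξ : ξ < ω₁) {M : Set ℕ} (hM : M.Infinite) :
    HasRankGE (treeOn (schreierFamily lam ξ) M) ξ [] :=
  (schreierFamily_induction (p := IsHereditarilyRanked) hlam isHereditarilyRanked_one
    isHereditarilyRanked_singletons (fun _ _ _ _ => IsHereditarilyRanked.mul)
    (fun _ ha _ _ hb h => isHereditarilyRanked_diagonal ha hb h) hξ).hasRankGE M hM

end RankOfFamilies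

section IdempotentUltrafilters

/-- `U + U = U` in the semigroup of ultrafilters on `M`, spelled out for the members of `U`. -/
def IsAddIdempotent {M : Type*} [Add M] (U : Ultrafilter M) : Prop :=
  ∀ s ∈ U, ∀ᶠ x in U, ∀ᶠ y in U, x + y ∈ s

theorem exists_isAddIdempotent {M : Type*} [AddSemigroup M] {A : ℕ → Set M} (hA : Antitone A)
    (hne : ∀ n, (A n).Nonempty) (hadd : ∀ n, ∀ x ∈ A n, ∃ m, ∀ y ∈ A m, x + y ∈ A n) :
    ∃ U : Ultrafilter M, IsAddIdempotent U ∧ ∀ n, A n ∈ U := by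
  let := Ultrafilter.addSemigroup (M := M)
  let K : ℕ → Set (Ultrafilter M) := fun n => {U | A n ∈ U}
  have hclosed : ∀ n, IsClosed (K n) := fun n => ultrafilter_isClosed_basic (A n)
  have hK : (⋂ n, K n).Nonempty := by
    refine IsCompact.nonempty_iInter_of_sequence_nonempty_isCompact_isClosed K
      (fun n U hU => mem_of_superset hU (hA n.le_succ)) (fun n => ?_) (hclosed 0).isCompact hclosed
    obtain ⟨x, hx⟩ := hne n
    exact ⟨pure x, hx⟩
  have hKadd : ∀ U ∈ ⋂ n, K n, ∀ V ∈ ⋂ n, K n, U + V ∈ ⋂ n, K n := by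
    refine fun U hU V hV => Set.mem_iInter.2 fun n => ?_
    refine (Ultrafilter.eventually_add U V (· ∈ A n)).2 ?_
    filter_upwards [Set.mem_iInter.1 hU n] with x hx
    obtain ⟨m, hm⟩ := hadd n x hx
    filter_upwards [Set.mem_iInter.1 hV m] with y hy using hm y hy
  obtain ⟨U, hU, hUU⟩ := exists_idempotent_in_compact_add_subsemigroup
    Ultrafilter.continuous_add_left (⋂ n, K n) hK (isClosed_iInter hclosed).isCompact hKadd
  refine ⟨U, fun s hs => (Ultrafilter.eventually_add U U (· ∈ s)).1 ?_, Set.mem_iInter.1 hU⟩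
  rwa [hUU]

variable {M : Type*} [AddSemigroup M] {U : Ultrafilter M} {A : Set M}

/-- The elements of `A` by which `A` can be translated back into itself along `U`. This subset of
`A` is closed under adding `U`-almost every element. -/
def addCore (U : Ultrafilter M) (A : Set M) : Set M := {x ∈ A | ∀ᶠ y in U, x + y ∈ A}

theorem IsAddIdempotent.addCore_mem (hU : IsAddIdempotent U) (hA : A ∈ U) : addCore U A ∈ U := by
  filter_upwards [hA, hU A hA] with x hx hxA using ⟨hx, hxA⟩

theorem IsAddIdempotent.eventually_add_mem_addCore (hU : IsAddIdempotent U) {x : M}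
    (hx : x ∈ addCore U A) : ∀ᶠ y in U, x + y ∈ addCore U A := by
  filter_upwards [hx.2, hU _ hx.2] with y hy hyz
  exact ⟨hy, by simpa only [Set.mem_ofPred_eq, ← add_assoc] using hyz⟩

end IdempotentUltrafilters

section BlockSums

variable {L L' D : Set ℕ} {S : List (Finset ℕ)} {s : Finset ℕ} {w : List ℕ}

/-- `S` is a finite sequence `s_1 < ⋯ < s_k` of nonempty finite subsets of `L`. In contrast to
`IsBlockSeq`, the empty sequence is allowed. -/
def IsBlocks (L : Set ℕ) (S : List (Finset ℕ)) : Prop :=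
  (∀ s ∈ S, s.Nonempty ∧ (↑s : Set ℕ) ⊆ L) ∧ S.Pairwise BlockLT

/-- `P(L)` together with the empty tuple, which makes it closed under initial segments. -/
def blockSums (L : Set ℕ) : Set (List ℕ) := {w | ∃ S, IsBlocks L S ∧ sumTuple S = w}

theorem allSums_subset_blockSums : allSums L ⊆ blockSums L := by
  simp only [allSums, finSumSet, Set.iUnion_subset_iff]
  rintro k - w ⟨S, hS, -, rfl⟩
  exact ⟨S, hS.2, rfl⟩

theorem isBlocks_concat :
    IsBlocks L (S ++ [s]) ↔
      IsBlocks L S ∧ (s.Nonempty ∧ (↑s : Set ℕ) ⊆ L) ∧ ∀ t ∈ S, BlockLT t s := by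
  simp only [IsBlocks, List.forall_mem_append, List.forall_mem_singleton, List.pairwise_append,
    List.pairwise_singleton, true_and]
  tauto

theorem sumTuple_concat (S : List (Finset ℕ)) (s : Finset ℕ) :
    sumTuple (S ++ [s]) = sumTuple S ++ [∑ l ∈ s, l] := by
  simp [sumTuple]

theorem nil_mem_blockSums (L : Set ℕ) : [] ∈ blockSums L :=
  ⟨[], ⟨by simp, .nil⟩, rfl⟩

theorem concat_mem_blockSums_iff {x : ℕ} :
    w ++ [x] ∈ blockSums L ↔
      ∃ S s, IsBlocks L (S ++ [s]) ∧ sumTuple S = w ∧ ∑ l ∈ s, l = x := by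
  constructor
  · rintro ⟨S, hS, hw⟩
    rcases List.eq_nil_or_concat' S with rfl | ⟨S, s, rfl⟩
    · simp [sumTuple] at hw
    · exact ⟨S, s, hS, by simpa [sumTuple_concat] using hw⟩
  · rintro ⟨S, s, hS, rfl, rfl⟩
    exact ⟨_, hS, sumTuple_concat S s⟩

theorem isPrefixClosed_blockSums (L : Set ℕ) : IsPrefixClosed (blockSums L) := by
  rintro v _ ⟨u, rfl⟩ hw
  induction u using List.reverseRecOn with
  | nil => simpa using hw
  | append_singleton u x ih =>
    rw [← List.append_assoc, concat_mem_blockSums_iff] at hw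
    obtain ⟨S, s, hS, hSw, -⟩ := hw
    exact ih ⟨S, (isBlocks_concat.1 hS).1, hSw⟩

theorem mem_blockSums_of_pairwise_lt (hw : ∀ x ∈ w, x ∈ L) (hlt : w.Pairwise (· < ·)) :
    w ∈ blockSums L := by
  refine ⟨w.map fun x => {x}, ⟨by simpa using hw, ?_⟩, by simp [sumTuple, Function.comp_def]⟩
  rw [List.pairwise_map]
  exact hlt.imp fun h => by simpa [BlockLT] using h

theorem exists_finite_mem_blockSums (hw : w ∈ blockSums L) :
    ∃ D ⊆ L, D.Finite ∧ w ∈ blockSums D := by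
  obtain ⟨S, hS, rfl⟩ := hw
  refine ⟨⋃ s ∈ S, ↑s, Set.iUnion₂_subset fun s hs => (hS.1 s hs).2,
    S.finite_toSet.biUnion fun s _ => s.finite_toSet, S, ⟨fun s hs => ⟨(hS.1 s hs).1, ?_⟩, hS.2⟩,
    rfl⟩
  exact Set.subset_biUnion_of_mem (u := fun s : Finset ℕ => (↑s : Set ℕ)) hs

theorem blockSums_mono (h : L ⊆ L') : blockSums L ⊆ blockSums L' := by
  rintro _ ⟨S, hS, rfl⟩
  exact ⟨S, ⟨fun s hs => ⟨(hS.1 s hs).1, (hS.1 s hs).2.trans h⟩, hS.2⟩, rfl⟩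

theorem le_sum_of_mem {x : ℕ} (hx : x ∈ s) : x ≤ ∑ l ∈ s, l :=
  Finset.single_le_sum (f := fun l => l) (fun _ _ => Nat.zero_le _) hx

/-- The sums of nonempty finite sets of elements of `L` larger than `N`. -/
def sumsAbove (L : Set ℕ) (N : ℕ) : Set ℕ :=
  {x | ∃ s : Finset ℕ, s.Nonempty ∧ (↑s : Set ℕ) ⊆ L ∧ (∀ l ∈ s, N < l) ∧ ∑ l ∈ s, l = x}

theorem antitone_sumsAbove (L : Set ℕ) : Antitone (sumsAbove L) := by
  rintro M N hMN _ ⟨s, hne, hsL, hs, rfl⟩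
  exact ⟨s, hne, hsL, fun l hl => hMN.trans_lt (hs l hl), rfl⟩

theorem lt_of_mem_sumsAbove {N x : ℕ} (hx : x ∈ sumsAbove L N) : N < x := by
  obtain ⟨s, ⟨l, hl⟩, -, hs, rfl⟩ := hx
  exact (hs l hl).trans_le (le_sum_of_mem hl)

theorem nonempty_sumsAbove (hL : L.Infinite) (N : ℕ) : (sumsAbove L N).Nonempty := by
  obtain ⟨l, hl, hN⟩ := hL.exists_gt N
  exact ⟨l, {l}, by simp, by simpa using hl, by simpa using hN, by simp⟩

theorem add_mem_sumsAbove {N x y : ℕ} (hx : x ∈ sumsAbove L N) (hy : y ∈ sumsAbove L (max N x)) :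
    x + y ∈ sumsAbove L N := by
  obtain ⟨s, hne, hsL, hs, rfl⟩ := hx
  obtain ⟨t, -, htL, ht, rfl⟩ := hy
  have hst : Disjoint s t := Finset.disjoint_left.2 fun l hls hlt =>
    (le_sum_of_mem hls).not_gt ((le_max_right _ _).trans_lt (ht l hlt))
  refine ⟨s ∪ t, hne.mono Finset.subset_union_left, by simp [hsL, htL], fun l hl => ?_,
    Finset.sum_union hst⟩
  rcases Finset.mem_union.1 hl with hl | hl
  · exact hs l hl
  · exact (le_max_left _ _).trans_lt (ht l hl)

theorem concat_mem_blockSums {x : ℕ} (hw : w ∈ blockSums L) (hx : x ∈ sumsAbove L w.sum) :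
    w ++ [x] ∈ blockSums L := by
  obtain ⟨S, hS, rfl⟩ := hw
  obtain ⟨s, hne, hsL, hs, rfl⟩ := hx
  refine ⟨S ++ [s], isBlocks_concat.2 ⟨hS, ⟨hne, hsL⟩, fun t ht x hx y hy => ?_⟩,
    sumTuple_concat S s⟩
  calc x ≤ ∑ l ∈ t, l := le_sum_of_mem hx
    _ ≤ (sumTuple S).sum := List.le_sum_of_mem (List.mem_map_of_mem ht)
    _ < y := hs y hy

theorem successors_blockSums_nonempty (hL : L.Infinite) (hw : w ∈ blockSums L) :
    (successors (blockSums L) w).Nonempty := by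
  obtain ⟨x, hx⟩ := nonempty_sumsAbove hL w.sum
  exact ⟨x, concat_mem_blockSums hw hx⟩

/-- Only the last block can contain `y`. -/
theorem mem_blockSums_insert {y : ℕ} (hD : ∀ x ∈ D, x < y) (hw : w ∈ blockSums (insert y D)) :
    w ∈ blockSums D ∨ (∃ v ∈ blockSums D, w = v ++ [y]) ∨
      ∃ v x, v ++ [x] ∈ blockSums D ∧ w = v ++ [x + y] := by
  rcases List.eq_nil_or_concat' w with rfl | ⟨w, z, rfl⟩
  · exact .inl (nil_mem_blockSums D)
  obtain ⟨S, s, hSs, rfl, rfl⟩ := concat_mem_blockSums_iff.1 hw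
  obtain ⟨hS, ⟨hne, hs⟩, hlt⟩ := isBlocks_concat.1 hSs
  have hle : ∀ x ∈ s, x ≤ y := fun x hx =>
    (hs hx).elim (fun h => h.le) fun h => (hD x h).le
  have hSD : IsBlocks D S := by
    refine ⟨fun t ht => ⟨(hS.1 t ht).1, fun x hx => ((hS.1 t ht).2 hx).resolve_left ?_⟩, hS.2⟩
    obtain ⟨z, hz⟩ := hne
    exact ((hlt t ht x hx z hz).trans_le (hle z hz)).ne
  have hsD : ↑(s.erase y) ⊆ D := fun x hx => by
    rw [Finset.mem_coe, Finset.mem_erase] at hx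
    exact (hs hx.2).resolve_left hx.1
  have hblocks : (s.erase y).Nonempty → IsBlocks D (S ++ [s.erase y]) := fun h =>
    isBlocks_concat.2 ⟨hSD, ⟨h, hsD⟩, fun t ht x hx z hz =>
      hlt t ht x hx z (Finset.mem_of_mem_erase hz)⟩
  by_cases hy : y ∈ s
  · rcases (s.erase y).eq_empty_or_nonempty with hs' | hs'
    · refine .inr (.inl ⟨sumTuple S, ⟨S, hSD, rfl⟩, ?_⟩)
      rw [← Finset.sum_erase_add _ _ hy, hs', Finset.sum_empty, zero_add]
    · exact .inr (.inr ⟨_, _, concat_mem_blockSums_iff.2 ⟨S, _, hblocks hs', rfl, rfl⟩, by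
        rw [Finset.sum_erase_add _ _ hy]⟩)
  · rw [Finset.erase_eq_of_notMem hy] at hblocks
    exact .inl (concat_mem_blockSums_iff.2 ⟨S, s, hblocks hne, rfl, rfl⟩)

theorem blockSums_empty : blockSums ∅ = {[]} := by
  refine Set.Subset.antisymm ?_ (Set.singleton_subset_iff.2 (nil_mem_blockSums ∅))
  rintro _ ⟨S, hS, rfl⟩
  rcases List.eq_nil_or_concat' S with rfl | ⟨S, s, rfl⟩
  · rfl
  · obtain ⟨-, ⟨⟨x, hx⟩, hs⟩, -⟩ := isBlocks_concat.1 hS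
    exact absurd (hs hx) (Set.notMem_empty x)

theorem finite_blockSums (hD : D.Finite) : (blockSums D).Finite := by
  obtain ⟨D, rfl⟩ := hD.exists_finset_coe
  induction D using Finset.induction_on_max with
  | empty =>
    rw [Finset.coe_empty, blockSums_empty]
    exact Set.finite_singleton []
  | insert y D hlt ih =>
    specialize ih D.finite_toSet
    refine ((ih.union (ih.image (· ++ [y]))).union
      (ih.image (List.modifyLast (· + y)))).subset fun w hw => ?_
    rw [Finset.coe_insert] at hw
    rcases mem_blockSums_insert hlt hw with hw | ⟨v, hv, rfl⟩ | ⟨v, x, hv, rfl⟩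
    · exact .inl (.inl hw)
    · exact .inl (.inr ⟨v, hv, rfl⟩)
    · exact .inr ⟨_, hv, List.modifyLast_concat _ _ _⟩

end BlockSums

section InfiniteSumSystems

variable {W : List ℕ → Set ℕ}

theorem isOfFiniteCharacter_blockSums_subset (A : Set (List ℕ)) :
    Order.IsOfFiniteCharacter {L | blockSums L ⊆ A} := by
  refine fun L => ⟨fun hL D hD _ => (blockSums_mono hD).trans hL, fun h w hw => ?_⟩
  obtain ⟨D, hDL, hD, hwD⟩ := exists_finite_mem_blockSums hw
  exact h D hDL hD hwD

theorem eventually_blockSums_insert_follows {U : Ultrafilter ℕ} (hU : IsAddIdempotent U)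
    (hW : ∀ p, W p ∈ U) {D : Set ℕ} (hD : D.Finite)
    (h : ∀ w ∈ blockSums D, Follows (fun p => addCore U (W p)) w) :
    ∀ᶠ y in U, (∀ x ∈ D, x < y) →
      ∀ w ∈ blockSums (insert y D), Follows (fun p => addCore U (W p)) w := by
  have hconcat : ∀ᶠ y in U, ∀ v ∈ blockSums D, y ∈ addCore U (W v) :=
    (eventually_all_finite (finite_blockSums hD)).2 fun v _ => hU.addCore_mem (hW v)
  have hadd : ∀ᶠ y in U, ∀ u ∈ blockSums D, ∀ v x, u = v ++ [x] → x + y ∈ addCore U (W v) := by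
    refine (eventually_all_finite (finite_blockSums hD)).2 fun u hu => ?_
    rcases List.eq_nil_or_concat' u with rfl | ⟨v, x, rfl⟩
    · simp
    · filter_upwards [hU.eventually_add_mem_addCore (follows_concat.1 (h _ hu)).2] with y hy
      intro v' x' heq
      obtain ⟨rfl, rfl⟩ : v = v' ∧ x = x' := by simpa using heq
      exact hy
  filter_upwards [hconcat, hadd] with y hconcat hadd hlt w hw
  rcases mem_blockSums_insert hlt hw with hw | ⟨v, hv, rfl⟩ | ⟨v, x, hv, rfl⟩
  · exact h w hw
  · exact follows_concat.2 ⟨h v hv, hconcat v hv⟩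
  · exact follows_concat.2 ⟨(follows_concat.1 (h _ hv)).1, hadd _ hv v x rfl⟩

/-- A maximal set all of whose block sums follow the additive cores of `W` is infinite. -/
theorem exists_infinite_blockSums_follows {U : Ultrafilter ℕ} (hU : IsAddIdempotent U)
    (hUtop : (U : Filter ℕ) ≤ atTop) (hW : ∀ p, W p ∈ U) :
    ∃ L : Set ℕ, L.Infinite ∧ ∀ w ∈ blockSums L, Follows W w := by
  let A : Set (List ℕ) := {w | Follows (fun p => addCore U (W p)) w}
  have hempty : blockSums ∅ ⊆ A := by
    rw [blockSums_empty, Set.singleton_subset_iff]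
    exact follows_nil _
  obtain ⟨L, -, hL, hmax⟩ :=
    (isOfFiniteCharacter_blockSums_subset A).exists_maximal (x := ∅) hempty
  refine ⟨L, fun hfin => ?_, fun w hw => Follows.mono (fun p x hx => hx.1) (hL hw)⟩
  have hlt : ∀ᶠ y in U, ∀ x ∈ L, x < y :=
    (eventually_all_finite hfin).2 fun x _ => hUtop (eventually_gt_atTop x)
  obtain ⟨y, hy, hyL⟩ := (hlt.and (eventually_blockSums_insert_follows hU hW hfin hL)).exists
  exact lt_irrefl y (hy y (hmax (hyL hy) (Set.subset_insert y L) (Set.mem_insert y L)))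

theorem exists_blockSums_subset_follows {L : Set ℕ} (hL : L.Infinite) :
    ∃ U : Ultrafilter ℕ, ∀ W : List ℕ → Set ℕ, (∀ p, W p ∈ U) →
      ∃ L' : Set ℕ, L'.Infinite ∧ blockSums L' ⊆ blockSums L ∧
        ∀ w ∈ blockSums L', Follows W w := by
  obtain ⟨U, hU, hUL⟩ := exists_isAddIdempotent (antitone_sumsAbove L) (nonempty_sumsAbove hL)
    fun _ _ hx => ⟨_, fun _ hy => add_mem_sumsAbove hx hy⟩
  have hUtop : (U : Filter ℕ) ≤ atTop :=
    tendsto_atTop.2 fun N => mem_of_superset (hUL N) fun _ hx => (lt_of_mem_sumsAbove hx).le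
  refine ⟨U, fun W hW => ?_⟩
  have hsums : ∀ p, W p ∩ {x | p ∈ blockSums L → p ++ [x] ∈ blockSums L} ∈ U := fun p =>
    inter_mem (hW p) (mem_of_superset (hUL p.sum) fun _ hx hp => concat_mem_blockSums hp hx)
  obtain ⟨L', hL', hfollows⟩ := exists_infinite_blockSums_follows hU hUtop hsums
  exact ⟨L', hL', fun w hw =>
    (hfollows w hw).induction (nil_mem_blockSums L) fun p x hx hp => hx.2 hp,
    fun w hw => (hfollows w hw).mono fun p => Set.inter_subset_left⟩

theorem exists_blockSums_avoids_or_bar {L : Set ℕ} (hL : L.Infinite) (G : Set (List ℕ)) :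
    ∃ L' : Set ℕ, L'.Infinite ∧ blockSums L' ⊆ blockSums L ∧
      ((∀ w ∈ blockSums L', w ∉ G) ∨ Bar (fun p => 𝓟 (successors (blockSums L') p)) G []) := by
  obtain ⟨U, hU⟩ := exists_blockSums_subset_follows hL
  obtain ⟨W, hWU, hW⟩ := exists_tree_avoids_or_bar U G
  obtain ⟨L', hL', hsub, hfollows⟩ := hU W hWU
  refine ⟨L', hL', hsub, hW.imp (fun h w hw => h w (hfollows w hw)) fun h =>
    h.mono_filter fun p _ => principal_mono.2 fun x hx => ?_⟩
  exact (follows_concat.1 (hfollows _ hx)).2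

end InfiniteSumSystems

section SumBases

variable {L L' : Set ℕ} {s t : Finset ℕ} {w : List ℕ}

theorem phiInv_mem_finSub (n : ℕ) : phiInv n ∈ finSub := by
  intro x hx
  obtain ⟨y, -, rfl⟩ := Finset.mem_image.1 hx
  exact Nat.le_add_left 1 y

theorem phiInv_nonempty {n : ℕ} (hn : 1 ≤ n) : (phiInv n).Nonempty := by
  rw [Finset.nonempty_iff_ne_empty]
  intro h
  have hphi := phi_phiInv n
  rw [h, phi, Finset.sum_empty] at hphi
  lia

theorem phi_lt_two_pow (hs : s ∈ finSub) {m : ℕ} (h : ∀ x ∈ s, x ≤ m) : phi s < 2 ^ m := by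
  have hinj : Set.InjOn (· - 1) (s : Set ℕ) := fun x hx y hy hxy => by
    have := hs x hx
    have := hs y hy
    lia
  rw [phi, ← Finset.sum_image (f := fun l => 2 ^ l) hinj]
  refine Nat.geomSum_lt le_rfl fun k hk => ?_
  obtain ⟨x, hx, rfl⟩ := Finset.mem_image.1 hk
  have := h x hx
  have := hs x hx
  lia

theorem lt_of_blockLT_phiInv {a b : ℕ} (hb : 1 ≤ b) (h : BlockLT (phiInv a) (phiInv b)) :
    a < b := by
  obtain ⟨m, hm⟩ := phiInv_nonempty hb
  calc a = phi (phiInv a) := (phi_phiInv a).symm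
    _ < 2 ^ (m - 1) := phi_lt_two_pow (phiInv_mem_finSub a) fun x hx => by
      have := h x hx m hm
      lia
    _ ≤ phi (phiInv b) :=
      Finset.single_le_sum (f := fun l => 2 ^ (l - 1)) (fun _ _ => Nat.zero_le _) hm
    _ = b := phi_phiInv b

theorem isLeast_minElt (h : s.Nonempty) : IsLeast (↑s : Set ℕ) (minElt s) :=
  ⟨Nat.sInf_mem h, fun _ hx => Nat.sInf_le hx⟩

theorem isLeast_c {n : ℕ} (hn : 1 ≤ n) : IsLeast (↑(phiInv n) : Set ℕ) (c n) :=
  isLeast_minElt (phiInv_nonempty hn)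

theorem c_lt_c {a b : ℕ} (ha : 1 ≤ a) (hb : 1 ≤ b) (h : BlockLT (phiInv a) (phiInv b)) :
    c a < c b :=
  h _ (isLeast_c ha).1 _ (isLeast_c hb).1

theorem IsSumBase.phiInv_sum (hL : IsSumBase L) (hs : (↑s : Set ℕ) ⊆ L) :
    phiInv (∑ l ∈ s, l) = s.biUnion phiInv := by
  have hdisj : (↑s : Set ℕ).PairwiseDisjoint phiInv := by
    intro a ha b hb hab
    refine Finset.disjoint_left.2 fun x hxa hxb => ?_
    rcases lt_or_gt_of_ne hab with h | h
    · exact lt_irrefl _ (hL.2.2 a (hs ha) b (hs hb) h x hxa x hxb)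
    · exact lt_irrefl _ (hL.2.2 b (hs hb) a (hs ha) h x hxb x hxa)
  have hmem : s.biUnion phiInv ∈ finSub := fun x hx => by
    obtain ⟨l, -, hl⟩ := Finset.mem_biUnion.1 hx
    exact phiInv_mem_finSub l x hl
  calc phiInv (∑ l ∈ s, l) = phiInv (∑ l ∈ s, phi (phiInv l)) := by simp only [phi_phiInv]
    _ = phiInv (phi (s.biUnion phiInv)) := by
      simp only [phi, Finset.sum_biUnion hdisj]
    _ = s.biUnion phiInv := phiInv_phi hmem

theorem IsSumBase.blockLT_phiInv_sum (hL : IsSumBase L) (hs : (↑s : Set ℕ) ⊆ L)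
    (ht : (↑t : Set ℕ) ⊆ L) (hst : BlockLT s t) :
    BlockLT (phiInv (∑ l ∈ s, l)) (phiInv (∑ l ∈ t, l)) := by
  rw [hL.phiInv_sum hs, hL.phiInv_sum ht]
  intro x hx y hy
  obtain ⟨a, ha, hxa⟩ := Finset.mem_biUnion.1 hx
  obtain ⟨b, hb, hyb⟩ := Finset.mem_biUnion.1 hy
  exact hL.2.2 a (hs ha) b (ht hb) (hst a ha b hb) x hxa y hyb

theorem IsSumBase.c_sum (hL : IsSumBase L) (hne : s.Nonempty) (hs : (↑s : Set ℕ) ⊆ L) :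
    c (∑ l ∈ s, l) = c (minElt s) := by
  have hmin := isLeast_minElt hne
  have hc := isLeast_c (hL.2.1 _ (hs hmin.1))
  refine (isLeast_c ((hL.2.1 _ (hs hmin.1)).trans (le_sum_of_mem hmin.1))).unique ?_
  rw [hL.phiInv_sum hs]
  refine ⟨Finset.mem_biUnion.2 ⟨_, hmin.1, hc.1⟩, fun x hx => ?_⟩
  obtain ⟨l, hl, hxl⟩ := Finset.mem_biUnion.1 hx
  rcases (hmin.2 hl).eq_or_lt with heq | hlt
  · exact hc.2 (heq ▸ hxl)
  · exact (hL.2.2 _ (hs hmin.1) l (hs hl) hlt _ hc.1 x hxl).le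

theorem IsSumBase.one_le (hL : IsSumBase L) (hw : w ∈ blockSums L) : ∀ x ∈ w, 1 ≤ x := by
  obtain ⟨S, hS, rfl⟩ := hw
  refine List.forall_mem_map.2 fun s hs => ?_
  obtain ⟨⟨l, hl⟩, hsL⟩ := hS.1 s hs
  exact (hL.2.1 l (hsL hl)).trans (le_sum_of_mem hl)

theorem IsSumBase.pairwise_blockLT (hL : IsSumBase L) (hw : w ∈ blockSums L) :
    w.Pairwise fun a b => BlockLT (phiInv a) (phiInv b) := by
  obtain ⟨S, hS, rfl⟩ := hw
  exact List.pairwise_map.2 <| hS.2.imp_of_mem fun hs ht =>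
    hL.blockLT_phiInv_sum (hS.1 _ hs).2 (hS.1 _ ht).2

theorem IsSumBase.pairwise_lt (hL : IsSumBase L) (hw : w ∈ blockSums L) : w.Pairwise (· < ·) :=
  (hL.pairwise_blockLT hw).imp_of_mem fun _ hb => lt_of_blockLT_phiInv (hL.one_le hw _ hb)

theorem IsSumBase.of_blockSums_subset (hL : IsSumBase L) (hL' : L'.Infinite)
    (h : blockSums L' ⊆ blockSums L) : IsSumBase L' := by
  refine ⟨hL', fun l hl => ?_, fun l hl l' hl' hlt => ?_⟩
  · exact hL.one_le (h (mem_blockSums_of_pairwise_lt (w := [l]) (by simpa using hl) (by simp)))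
      l (by simp)
  · simpa using hL.pairwise_blockLT
      (h (mem_blockSums_of_pairwise_lt (w := [l, l']) (by simp [hl, hl']) (by simpa using hlt)))

theorem IsSumBase.strictMonoOn_c (hL : IsSumBase L) : StrictMonoOn c L :=
  fun a ha b hb hab => c_lt_c (hL.2.1 a ha) (hL.2.1 b hb) (hL.2.2 a ha b hb hab)

theorem IsSumBase.avoids_or_bar (hL : IsSumBase L) (G : Set (List ℕ)) :
    ∃ L', IsSumBase L' ∧ blockSums L' ⊆ blockSums L ∧
      ((∀ w ∈ blockSums L', w ∉ G) ∨ Bar (fun p => 𝓟 (successors (blockSums L') p)) G []) := by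
  obtain ⟨L', hL', hsub, h⟩ := exists_blockSums_avoids_or_bar hL.1 G
  exact ⟨L', hL.of_blockSums_subset hL' hsub, hsub, h⟩

theorem isSumBase_range_two_pow : IsSumBase (Set.range fun k => 2 ^ k) := by
  have hphi : ∀ k, phiInv (2 ^ k) = {k + 1} := fun k => by simp [phiInv]
  refine ⟨Set.infinite_range_of_injective (Nat.pow_right_injective le_rfl), ?_, ?_⟩
  · rintro _ ⟨k, rfl⟩
    exact Nat.one_le_two_pow
  · rintro _ ⟨k, rfl⟩ _ ⟨k', rfl⟩ h
    simpa [hphi, BlockLT] using (Nat.pow_lt_pow_iff_right (le_refl 2)).1 h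

end SumBases

section Ranks

variable {lam : Ordinal.{0} → ℕ → Ordinal.{0}} {ξ : Ordinal.{0}} {L : Set ℕ} {F : Set (Finset ℕ)}
  {w : List ℕ}

theorem IsSumBase.sumSet_subset (hL : IsSumBase L) :
    sumSet lam ξ L ⊆ {w ∈ blockSums L | w.map c ∈ tuples (schreierFamily lam ξ)} := by
  rintro _ ⟨S, hS, hc, rfl⟩
  refine ⟨⟨S, hS.2, rfl⟩, ?_⟩
  have hmap : (sumTuple S).map c = S.map fun s => c (minElt s) := by
    rw [sumTuple, List.map_map]
    exact List.map_congr_left fun s hs => hL.c_sum (hS.2.1 s hs).1 (hS.2.1 s hs).2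
  rwa [hmap]

theorem IsThin.mem_of_bar {B : Set (Finset ℕ)} (hB : IsThin B) (hL : L.Infinite)
    {P : Set (List ℕ)} {f : ℕ → ℕ}
    (h : Bar (fun p => 𝓟 (successors (blockSums L) p)) {w ∈ P | w.map f ∈ tuples B} [])
    (hw : w ∈ blockSums L) (hwB : w.map f ∈ tuples B) : w ∈ P := by
  obtain ⟨g, hg, hgw⟩ := h.exists_comparable (isPrefixClosed_blockSums L)
    (fun _ => successors_blockSums_nonempty hL) (nil_mem_blockSums L) hw (.inl List.nil_prefix)
  have hmap : g.map f = w.map f := hgw.elim (fun h => hB.eq_of_prefix hg.2 hwB (h.map f))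
    fun h => (hB.eq_of_prefix hwB hg.2 (h.map f)).symm
  have hlen : g.length = w.length := by simpa using congrArg List.length hmap
  obtain rfl : g = w := hgw.elim (·.eq_of_length hlen) fun h => (h.eq_of_length hlen.symm).symm
  exact hg.1

theorem IsTree.mem_of_isInitialSegment (hF : IsTree F) {s t : Finset ℕ} (hs : s ∈ F)
    (h : IsInitialSegment t s) : t ∈ F :=
  hF ▸ .inl ⟨s, hs, h⟩

/-- The tree `treeOn (schreierFamily lam ξ) (c '' L)` is embedded by inverting `c` on `L`. -/
theorem IsSumBase.hasRankGE_of_sums_mem (hL : IsSumBase L) (hlam : IsLimitChoice lam)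
    (hF : IsTree F) (hξ : ξ < ω₁)
    (h : ∀ w ∈ blockSums L, w.map c ∈ tuples (schreierFamily lam ξ) → w.toFinset ∈ F) :
    HasRankGE {w ∈ blockSums L | w.toFinset ∈ F} ξ [] := by
  have hc := hL.strictMonoOn_c
  let e := Function.invFunOn c L
  have he : ∀ m ∈ c '' L, e m ∈ L ∧ c (e m) = m := fun m hm => Function.invFunOn_pos hm
  have hrank := hasRankGE_treeOn_schreierFamily hlam hξ (hL.1.image hc.injOn)
  refine hrank.map (f := List.map e) (fun w x => ⟨e x, by simp⟩) ?_
  rintro v ⟨u, hu, huM, hvu⟩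
  have hcu : (u.map e).map c = u := by
    rw [List.map_map]
    exact (List.map_congr_left fun x hx => (he x (huM x hx)).2).trans (List.map_id' u)
  have hlt : (u.map e).Pairwise (· < ·) := List.pairwise_map.2 <| hu.1.imp_of_mem
    fun ha hb hab => by
      rwa [← hc.lt_iff_lt (he _ (huM _ ha)).1 (he _ (huM _ hb)).1, (he _ (huM _ ha)).2,
        (he _ (huM _ hb)).2]
  have hsums : u.map e ∈ blockSums L :=
    mem_blockSums_of_pairwise_lt (List.forall_mem_map.2 fun x hx => (he x (huM x hx)).1) hlt
  exact ⟨isPrefixClosed_blockSums L (hvu.map e) hsums, hF.mem_of_isInitialSegment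
    (h _ hsums (by rwa [hcu])) (isInitialSegment_of_prefix hlt (hvu.map e))⟩

end Ranks

end BlockRamsey

theorem corollary3p6 (lam : Ordinal.{0} → ℕ → Ordinal.{0}) (hlam : BlockRamsey.IsLimitChoice lam)
    (F : Set (Finset ℕ)) (hF : F ⊆ BlockRamsey.finSub) (hTree : BlockRamsey.IsTree F) :
    (∃ L : Set ℕ, BlockRamsey.IsSumBase L ∧
      BlockRamsey.allSums L ⊆ BlockRamsey.tuples F) ∨
    (∃ ξ₀ : Ordinal.{0}, ξ₀ < Ordinal.omega 1 ∧
      ∀ ξ : Ordinal.{0}, ξ₀ < ξ → ξ < Ordinal.omega 1 →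
        ∃ L : Set ℕ, BlockRamsey.IsSumBase L ∧
          BlockRamsey.sumSet lam ξ L ⊆ BlockRamsey.tuples (BlockRamsey.finSub \ F)) := by
  obtain ⟨L, hL, -, havoid | hbar⟩ :=
    BlockRamsey.isSumBase_range_two_pow.avoids_or_bar {w | w.toFinset ∉ F}
  · exact .inl ⟨L, hL, fun w hw =>
      have hw := BlockRamsey.allSums_subset_blockSums hw
      ⟨hL.pairwise_lt hw, not_not.1 (havoid w hw)⟩⟩
  obtain ⟨ξ₀, hξ₀, hrank⟩ := hbar.exists_not_hasRankGE
  refine .inr ⟨ξ₀, hξ₀, fun ξ hlt hξ => ?_⟩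
  obtain ⟨L', hL', hsub, havoid | hbar⟩ := hL.avoids_or_bar {w ∈ {w | w.toFinset ∈ F} |
    w.map BlockRamsey.c ∈ BlockRamsey.tuples (BlockRamsey.schreierFamily lam ξ)}
  · refine ⟨L', hL', fun w hw => ?_⟩
    obtain ⟨hw, hwc⟩ := hL'.sumSet_subset hw
    exact ⟨hL'.pairwise_lt hw, fun x hx => hL'.one_le hw x (List.mem_toFinset.1 hx),
      fun hwF => havoid w hw ⟨hwF, hwc⟩⟩
  · have hmem := hL'.hasRankGE_of_sums_mem hlam hTree hξ fun w =>
      (BlockRamsey.isThin_schreierFamily hlam hξ).mem_of_bar hL'.1 hbar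
    have hsubset : {w ∈ BlockRamsey.blockSums L' | w.toFinset ∈ F} ⊆
        BlockRamsey.blockSums L \ {w | w.toFinset ∉ F} := fun w hw =>
      ⟨hsub hw.1, not_not.2 hw.2⟩
    exact absurd ((hmem.subset hsubset).mono hlt.le) hrank
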